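/- **Setting.** Two players choose $\alpha_1,\alpha_2$ in the scalar game $\dot x=\alpha_1+\alpha_2$, $x(0)=y$, and player $i$ minimizes $J_i=\int_0^\infty e^{-t}\big[h_i(x(t))+\tfrac12\alpha_i(t)^2\big]\,dt$. Let $h_1,h_2:\mathbb R\to\mathbb R$ be continuous with $h_i'=\kappa_i^0$ for $x<0$ and $h_i'=\kappa_i^1$ for $x>0$, and put $K^j=(\kappa_1^j,\kappa_2^j)$. Assume $\kappa^0_1,\kappa^0_2<0<\kappa^1_1,\kappa^1_2$, $\kappa_1^0\ne\kappa_2^0$, $\kappa_1^1\neq\kappa_2^1$ (that is, $K^0\in\mathcal A_5\cup\mathcal A_6$, $K^1\in\mathcal A_1\cup\mathcal A_2$, with $\mathcal A_k$ the open sector of angles $](k-1)\pi/4,k\pi/4[$) and $\alpha^0\neq\alpha^1$, where $\alpha^j=\kappa_2^j/\kappa_1^j$. An *admissible solution* is a (locally) absolutely continuous $u=(u_1,u_2):\mathbb R\to\mathbb R^2$ with $u_i=h_i-u_1'u_2'-\tfrac12(u_i')^2$ a.e. ($i=1,2$), with $|u(x)|\le C(1+|x|)$ for some $C$, and such that $u'$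 has one-sided limits at every $y$, satisfying $u_1'(y+)+u_2'(y+)\le0$ or $u_1'(y-)+u_2'(y-)\ge0$ wherever $u'$ is discontinuous. A feedback pair $(\alpha_1^*,\alpha_2^*)$ with values in control sets $A_1,A_2\subset\mathbb R$ is a *Nash equilibrium* if for each $y$ the problem $\dot x=\alpha_1^*(x)+\alpha_2^*(x)$, $x(0)=y$, has a Carathéodory solution on $[0,\infty[$, and along each such solution the cost of each player $i$ is finite and is minimal among the costs of all measurable controls $\alpha_i:[0,\infty[\to A_i$ and all solutions of $\dot x=\alpha_i(t)+\alpha_j^*(x)$, $x(0)=y$, $j\ne i$. For $K=(\kappa_1,\kappa_2)$ consider the system $$\frac{dp_1}{ds}=(\kappa_1-\kappa_2)p_1+\kappa_1p_2-p_1^2,\qquad \frac{dp_2}{ds}=(\kappa_2-\kappa_1)p_2+\kappa_2p_1-p_2^2;$$ it is called *negative* for $K=K^0$ and *positive* for $K=K^1$. Let $G_-(\alpha)=\alpha-1-\sqrt{\alpha^2-\alpha+1}$ and $\Delta(p)=(p_1+p_2)^2-p_1p_2$, and let $$\Omega=\{p_1<0<p_2,\ G_-(\alpha^0)<p_2/p_1<G_-(\alpha^1)\}\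 \text{ if }\alpha^0<\alpha^1,\qquad \Omega=\{p_2<0<p_1,\ G_-(\alpha^1)<p_2/p_1<G_-(\alpha^0)\}\ \text{ if }\alpha^1<\alpha^0 .$$ Say that $p^{\rm in}\in\mathbb R^2$ *gives a solution* if there is a unique continuous $p:\mathbb R\to\mathbb R^2$ with $p(0)=p^{\rm in}$ that solves the negative system for $s<0$ and the positive system for $s>0$; this $p$ tends to $K^0$ as $s\to-\infty$ and to $K^1$ as $s\to+\infty$; the change of variable $dx/ds=\Delta(p(s))$, $x(0)=0$, is a bijection of $\mathbb R$; and there is an admissible solution $u$, differentiable everywhere, with $u'(x(s))=p(s)$ for all $s$, for which $(-u_1',-u_2')$ is a Nash equilibrium for all control sets $A_1,A_2$ that contain the values of $-u_1'$ and $-u_2'$ respectively. **Theorem.** 1. $\Omega\neq\emptyset$, and for all $a\le b$ such that $[a,b]$ lies in the open interval with end points $G_-(\alpha^0)$ and $G_-(\alpha^1)$ there is $\varepsilon>0$ such that every $p^{\rm in}\in\Omega$ with $p_2^{\rm in}/p_1^{\rm in}\in[a,b]$ and $|p^{\rm in}|<\varepsilon$ gives a solution. 2. More precisely, there are $\varepsilon>0$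 and functions $\varphi_0,\varphi_1$, continuous on $]-\varepsilon,\varepsilon[$, with $\varphi_j(0)=0$ and $\varphi_j'(0)=G_-(\alpha^j)$, such that in $\{|p|<\varepsilon\}$ the set of points whose orbit under the negative system tends to the origin as $s\to-\infty$ is the curve $p_2=\varphi_0(p_1)$, the set of points whose orbit under the positive system tends to the origin as $s\to+\infty$ is the curve $p_2=\varphi_1(p_1)$, and every $p^{\rm in}$ with $|p^{\rm in}|<\varepsilon$ and $\varphi_1(p^{\rm in}_1)<p^{\rm in}_2<\varphi_0(p^{\rm in}_1)$ gives a solution. 3. There are infinitely many admissible solutions. Moreover there is $R$ such that for all control sets $A_1,A_2\supseteq[-R,R]$ there are infinitely many Nash equilibria of the form $(-u_1',-u_2')$ with $u$ admissible. -/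

import Mathlib

open Set Filter Topology MeasureTheory

noncomputable section

/-! Players, and the two components of vectors, are indexed by `Fin 2`: the index `0` stands for
the first player or component and the index `1` for the second; `1 - i` is the opponent of `i`. -/

/-- The open sector `𝒜_k` of angles `](k-1)π/4, kπ/4[` (origin excluded). -/
def sector (k : ℕ) : Set (Fin 2 → ℝ) :=
  {p | ∃ ρ θ : ℝ, 0 < ρ ∧ θ ∈ Ioo (((k : ℝ) - 1) * (Real.pi / 4)) ((k : ℝ) * (Real.pi / 4)) ∧
    p = ![ρ * Real.cos θ, ρ * Real.sin θ]}

/-- The slope ratio `α = κ₂ / κ₁`. -/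
def slopeRatio (K : Fin 2 → ℝ) : ℝ := K 1 / K 0

/-- The eigen-direction map `G_-(α) = α - 1 - √(α² - α + 1)`. -/
def Gminus (α : ℝ) : ℝ := α - 1 - Real.sqrt (α ^ 2 - α + 1)

/-- The open cone between the directions `G_-(α⁰)` and `G_-(α¹)`, taken in the second quadrant
if `α⁰ < α¹` and in the fourth quadrant if `α¹ < α⁰`. -/
def coneOmega (α₀ α₁ : ℝ) : Set (Fin 2 → ℝ) :=
  {p | (α₀ < α₁ ∧ p 0 < 0 ∧ 0 < p 1 ∧ Gminus α₀ < p 1 / p 0 ∧ p 1 / p 0 < Gminus α₁) ∨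
       (α₁ < α₀ ∧ p 1 < 0 ∧ 0 < p 0 ∧ Gminus α₁ < p 1 / p 0 ∧ p 1 / p 0 < Gminus α₀)}

/-- The determinant `Δ(p)` of the matrix `Λ(p)` with rows `(p₁ + p₂, p₁)` and `(p₂, p₁ + p₂)`. -/
def Delta (p : Fin 2 → ℝ) : ℝ := (!![p 0 + p 1, p 0; p 1, p 0 + p 1] : Matrix _ _ ℝ).det

/-- Right-hand side of the system for `p = u'` in the variable `s`, where the cost slopes
`(h₁', h₂')` have the value `K`. -/
def slopeField (K p : Fin 2 → ℝ) : Fin 2 → ℝ :=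
  ![(K 0 - K 1) * p 0 + K 0 * p 1 - p 0 ^ 2, (K 1 - K 0) * p 1 + K 1 * p 0 - p 1 ^ 2]

/-- `p` follows the system with slopes `K₀` for `s < 0`, the system with slopes `K₁` for `s > 0`,
and is continuous. -/
def IsTrajectory (K₀ K₁ : Fin 2 → ℝ) (p : ℝ → Fin 2 → ℝ) : Prop :=
  Continuous p ∧ (∀ s < 0, HasDerivAt p (slopeField K₀ (p s)) s) ∧
    (∀ s > 0, HasDerivAt p (slopeField K₁ (p s)) s)

/-- Points from which the solution of the system with slopes `K` exists for all `s ≥ 0` and tends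
to the origin as `s → +∞`. -/
def stableSet (K : Fin 2 → ℝ) : Set (Fin 2 → ℝ) :=
  {q | ∃ p : ℝ → Fin 2 → ℝ, p 0 = q ∧
    (∀ s ≥ 0, HasDerivWithinAt p (slopeField K (p s)) (Ici 0) s) ∧ Tendsto p atTop (𝓝 0)}

/-- Points from which the solution of the system with slopes `K` exists for all `s ≤ 0` and tends
to the origin as `s → -∞`. -/
def unstableSet (K : Fin 2 → ℝ) : Set (Fin 2 → ℝ) :=
  {q | ∃ p : ℝ → Fin 2 → ℝ, p 0 = q ∧
    (∀ s ≤ 0, HasDerivWithinAt p (slopeField K (p s)) (Iic 0) s) ∧ Tendsto p atBot (𝓝 0)}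

/-- Admissible solution of the Hamilton-Jacobi system
`u_i = h_i - u₁' u₂' - (u_i')² / 2`, `i = 1, 2`. -/
structure IsAdmissible (h u : Fin 2 → ℝ → ℝ) : Prop where
  absCont : ∀ i a b, AbsolutelyContinuousOnInterval (u i) a b
  /-- The system holds almost everywhere. -/
  eqn : ∀ᵐ x : ℝ, ∀ i, DifferentiableAt ℝ (u i) x ∧
    u i x = h i x - deriv (u 0) x * deriv (u 1) x - deriv (u i) x ^ 2 / 2
  growth : ∃ C : ℝ, ∀ i x, |u i x| ≤ C * (1 + |x|)
  /-- At every point `y` the derivative, where it exists, has a left limit `l` and a right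
  limit `r`, and these satisfy the jump condition where they differ. -/
  jumps : ∀ y : ℝ, ∃ l r : Fin 2 → ℝ,
    (∀ i, Tendsto (deriv (u i)) (𝓝[{x | x < y ∧ DifferentiableAt ℝ (u i) x}] y) (𝓝 (l i))) ∧
    (∀ i, Tendsto (deriv (u i)) (𝓝[{x | y < x ∧ DifferentiableAt ℝ (u i) x}] y) (𝓝 (r i))) ∧
    (l ≠ r → r 0 + r 1 ≤ 0 ∨ 0 ≤ l 0 + l 1)

/-- `x` is a Carathéodory solution on `[0, ∞[` of `x' = f(t, x)`, `x(0) = y`. -/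
def IsCaratheodory (f : ℝ → ℝ → ℝ) (y : ℝ) (x : ℝ → ℝ) : Prop :=
  x 0 = y ∧ (∀ T > 0, AbsolutelyContinuousOnInterval x 0 T) ∧
    ∀ᵐ t ∂(volume.restrict (Ioi (0 : ℝ))), HasDerivAt x (f t (x t)) t

/-- The discounted running cost `e^{-t} [h(x(t)) + a(t)² / 2]`. -/
def runningCost (h : ℝ → ℝ) (x a : ℝ → ℝ) (t : ℝ) : ℝ :=
  Real.exp (-t) * (h (x t) + a t ^ 2 / 2)

/-- The cost `J = ∫₀^∞ e^{-t} [h(x(t)) + a(t)² / 2] dt` as an extended real number: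
integral of the positive part minus integral of the negative part. -/
def cost (h : ℝ → ℝ) (x a : ℝ → ℝ) : EReal :=
  ((∫⁻ t in Ioi (0 : ℝ), ENNReal.ofReal (runningCost h x a t) : ENNReal) : EReal) -
    ((∫⁻ t in Ioi (0 : ℝ), ENNReal.ofReal (-runningCost h x a t) : ENNReal) : EReal)

/-- The feedback pair `α` is a Nash equilibrium solution of the game with dynamics
`x' = α₁ + α₂`, running costs `h_i + α_i² / 2`, discount `e^{-t}`, and control sets `A_i`. -/
structure IsNash (A : Fin 2 → Set ℝ) (h α : Fin 2 → ℝ → ℝ) : Prop where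
  measurable : ∀ i, Measurable (α i)
  mem : ∀ i x, α i x ∈ A i
  /-- The closed-loop Cauchy problem is solvable for every initial state. -/
  exists_sol : ∀ y, ∃ x, IsCaratheodory (fun _ z => α 0 z + α 1 z) y x
  /-- Along every closed-loop trajectory the cost of each player is finite. -/
  finite_cost : ∀ y x, IsCaratheodory (fun _ z => α 0 z + α 1 z) y x →
    ∀ i, IntegrableOn (runningCost (h i) x (fun t => α i (x t))) (Ioi 0)
  /-- Along every closed-loop trajectory the cost of each player `i` is the minimum of his
  costs over all open-loop controls `a` and trajectories of `z' = a(t) + α_j(z)`, `j ≠ i`. -/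
  optimal : ∀ y x, IsCaratheodory (fun _ z => α 0 z + α 1 z) y x →
    ∀ i, ∀ a z : ℝ → ℝ, AEMeasurable a (volume.restrict (Ioi 0)) →
      (∀ᵐ t ∂(volume.restrict (Ioi (0 : ℝ))), a t ∈ A i) →
      IsCaratheodory (fun t w => a t + α (1 - i) w) y z →
      cost (h i) x (fun t => α i (x t)) ≤ cost (h i) z a

/-- The feedback pair `α_i = -u_i'`. -/
def feedback (u : Fin 2 → ℝ → ℝ) : Fin 2 → ℝ → ℝ := fun i x => -deriv (u i) x

/-- The initial point `q` gives an admissible solution: the trajectory `p` with `p(0) = q` exists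
for all `s`, is unique, tends to `K₀` as `s → -∞` and to `K₁` as `s → +∞`, and corresponds,
through the change of variable `x = x(s)` with `dx/ds = Δ(p)` and `x(0) = 0`, to an admissible
solution `u` with `u'(x(s)) = p(s)`. Moreover `-u'` is a Nash equilibrium for all control sets
that contain its values. -/
def GivesSolution (h : Fin 2 → ℝ → ℝ) (K₀ K₁ q : Fin 2 → ℝ) : Prop :=
  ∃ p : ℝ → Fin 2 → ℝ, p 0 = q ∧ IsTrajectory K₀ K₁ p ∧
    (∀ p', IsTrajectory K₀ K₁ p' → p' 0 = q → p' = p) ∧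
    Tendsto p atBot (𝓝 K₀) ∧ Tendsto p atTop (𝓝 K₁) ∧
    ∃ (X : ℝ → ℝ) (u : Fin 2 → ℝ → ℝ),
      X 0 = 0 ∧ (∀ s, HasDerivAt X (Delta (p s)) s) ∧ Function.Bijective X ∧
      (∀ i s, HasDerivAt (u i) (p s i) (X s)) ∧ IsAdmissible h u ∧
      ∀ A : Fin 2 → Set ℝ, (∀ i x, feedback u i x ∈ A i) → IsNash A h (feedback u)

end

/-! For a C¹ solution put p = u'. Differentiating the two Hamilton-Jacobi equations and rescaling by
dx/ds = Δ(p) turns them into the polynomial system `slopeField K`, and u is recovered from p by the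
equations themselves, without integration. Since Δ is a positive definite form, a bounded trajectory
that runs from K⁰ to K¹ and avoids the origin has Δ(p) bounded below, so the change of variable is a
Lipschitz-invertible bijection and u is differentiable with bounded Lipschitz gradient. It remains
to find such trajectories and to verify the equilibrium property.

Trajectories. For slopes K = (k, l) with k, l > 0 the origin is a saddle: the linear part has rows
(k - l, k) and (l, l - k) and eigenvalues ±λ, λ² = k² - kl + l². The system is cooperative, hence
order preserving (`ClampSol.le_of_le`), and the open first and third quadrants are positively
invariant. Points that enter the first quadrant form an open upper set, points that enter the third
an open lower set, and the two are disjoint. On a short vertical segment near the origin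
connectedness yields a point in neither. Such a point decays to the origin
(`ClampSol.decay_of_avoid`), and two ordered solutions cannot both do so
(`ClampSol.not_tendsto_zero_of_lt`), so there is exactly one: these points form the stable curve.
The left eigenvector of λ gives its tangent, of slope G₋(l/k). Small points above the curve enter
the first quadrant, and logistic barriers drive them to K. All this is `exists_stableCurve`,
obtained by comparison arguments instead of an invariant manifold theorem.

The reflection p(s) ↦ -p(-s) exchanges slopes K and -K, so the same result at -K⁰ gives the unstable
curve of the negative system, and points below that curve run back to K⁰. As G₋ is increasing,
closed subcones of Ω lie between the two curves near the origin.

Equilibrium. Along a trajectory in which player i uses a control a against the feedback of the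
opponent, the discounted value e^{-t} u_i(z) plus the accumulated cost has derivative e^{-t}(a +
u_i')²/2 ≥ 0, with equality for the feedback. This gives optimality once the boundary term at
infinity is controlled (`RegularSolution.value_le_integral`, `RegularSolution.integral_closedLoop`).
-/

/-! ### Ordinary differential equations -/

/-- A bounded Lipschitz vector field has a global integral curve through every point. -/
theorem exists_global_integralCurve {E : Type*} [NormedAddCommGroup E] [NormedSpace ℝ E]
    [CompleteSpace E] {F : E → E} {κ : NNReal} (hF : LipschitzWith κ F) {M : ℝ}
    (hM : ∀ x, ‖F x‖ ≤ M) (q : E) :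
    ∃ p : ℝ → E, p 0 = q ∧ ∀ t, HasDerivAt p (F (p t)) t := by
  have hM0 : 0 ≤ M := (norm_nonneg _).trans (hM 0)
  have hex : ∀ n : ℕ, ∃ p : ℝ → E, p 0 = q ∧
      ∀ t ∈ Ioo (-((n : ℝ) + 1)) (n + 1), HasDerivAt p (F (p t)) t := by
    intro n
    have h0 : (0 : ℝ) ∈ Icc (-((n : ℝ) + 1)) (n + 1) := ⟨by linarith [n.cast_nonneg (α := ℝ)],
      by positivity⟩
    -- The global bound M makes the ball of radius M(n + 1) large enough for the whole interval, so
    -- the time of existence is arbitrary.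
    have hpl : IsPicardLindelof (fun _ => F) (⟨0, h0⟩ : Icc (-((n : ℝ) + 1)) ((n : ℝ) + 1)) q
        (M.toNNReal * ((n : NNReal) + 1)) 0 M.toNNReal κ :=
      { lipschitzOnWith := fun _ _ => hF.lipschitzOnWith
        continuousOn := fun _ _ => continuousOn_const
        norm_le := fun _ _ x _ => by simpa [hM0] using hM x
        mul_max_le := by simp }
    obtain ⟨p, hp0, hp⟩ := hpl.exists_eq_forall_mem_Icc_hasDerivWithinAt₀
    exact ⟨p, hp0, fun t ht => (hp t (Ioo_subset_Icc_self ht)).hasDerivAt (Icc_mem_nhds ht.1 ht.2)⟩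
  choose p hp0 hp using hex
  have hag : ∀ m n : ℕ, ∀ t : ℝ, |t| < m + 1 → |t| < n + 1 → p m t = p n t := by
    intro m n t hm hn
    have key : ∀ a : ℝ, a ≤ m + 1 → a ≤ n + 1 → |t| < a → p m t = p n t := by
      intro a ham han hta
      have h0 : (0 : ℝ) ∈ Ioo (-a) a := by
        have := (abs_nonneg t).trans_lt hta
        constructor <;> linarith
      refine ODE_solution_unique_of_mem_Ioo (v := fun _ => F) (s := fun _ => univ) (K := κ)
        (fun _ _ => hF.lipschitzOnWith) h0
        (fun s hs => ⟨hp m s ⟨by linarith [hs.1], by linarith [hs.2]⟩, trivial⟩)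
        (fun s hs => ⟨hp n s ⟨by linarith [hs.1], by linarith [hs.2]⟩, trivial⟩)
        ((hp0 m).trans (hp0 n).symm) (abs_lt.1 hta)
    exact key (min (m + 1) (n + 1)) (min_le_left _ _) (min_le_right _ _) (lt_min hm hn)
  -- The local solutions agree on overlaps; at time t the one with index ⌊|t|⌋ is defined on a
  -- neighbourhood of t.
  have hfl : ∀ t : ℝ, |t| < ((⌊|t|⌋₊ : ℕ) : ℝ) + 1 := fun t => Nat.lt_floor_add_one _
  refine ⟨fun t => p ⌊|t|⌋₊ t, by simpa using hp0 0, fun t => ?_⟩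
  have ht := abs_lt.1 (hfl t)
  refine (hp ⌊|t|⌋₊ t ht).congr_of_eventuallyEq ?_
  filter_upwards [continuous_abs.continuousAt.eventually (gt_mem_nhds (hfl t))] with s hs
  exact hag _ _ s (hfl s) hs

/-- Two functions that are positive at `0`, and each of which has positive derivative wherever it
vanishes while the other one is nonnegative, stay positive. -/
theorem pos_of_deriv_pos_of_eq_zero {g₁ g₂ g₁' g₂' : ℝ → ℝ}
    (hc₁ : ContinuousOn g₁ (Ici 0)) (hc₂ : ContinuousOn g₂ (Ici 0))
    (hd₁ : ∀ s > 0, HasDerivAt g₁ (g₁' s) s) (hd₂ : ∀ s > 0, HasDerivAt g₂ (g₂' s) s)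
    (h₁ : 0 < g₁ 0) (h₂ : 0 < g₂ 0)
    (hz₁ : ∀ s > 0, g₁ s = 0 → 0 ≤ g₂ s → 0 < g₁' s)
    (hz₂ : ∀ s > 0, g₂ s = 0 → 0 ≤ g₁ s → 0 < g₂' s) :
    ∀ s ≥ 0, 0 < g₁ s ∧ 0 < g₂ s := by
  by_contra! hcon
  obtain ⟨t, ht, hneg⟩ := hcon
  set m : ℝ → ℝ := fun s => min (g₁ s) (g₂ s) with hm
  have hmc : ContinuousOn m (Ici 0) := hc₁.inf hc₂
  have hmt : m t ≤ 0 := by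
    rcases lt_or_ge 0 (g₁ t) with h | h
    · exact (min_le_right _ _).trans (hneg h)
    · exact (min_le_left _ _).trans h
  set Z : Set ℝ := Icc 0 t ∩ m ⁻¹' Iic 0 with hZ
  have hZc : IsClosed Z :=
    (hmc.mono Icc_subset_Ici_self).preimage_isClosed_of_isClosed isClosed_Icc isClosed_Iic
  have hZne : Z.Nonempty := ⟨t, ⟨ht, le_rfl⟩, hmt⟩
  have hZb : BddBelow Z := ⟨0, fun s hs => hs.1.1⟩
  set τ := sInf Z with hτ
  have hτZ : τ ∈ Z := hZc.csInf_mem hZne hZb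
  have hbefore : ∀ s, 0 ≤ s → s < τ → 0 < m s := by
    intro s hs hsτ
    by_contra! hle
    exact absurd (csInf_le hZb (show s ∈ Z from ⟨⟨hs, hsτ.le.trans hτZ.1.2⟩, hle⟩)) (not_le.2 hsτ)
  have hm0 : 0 < m 0 := lt_min h₁ h₂
  have hτ0 : 0 < τ := by
    rcases hτZ.1.1.lt_or_eq with h | h
    · exact h
    · exact absurd hτZ.2 (by rw [← h]; simpa using hm0)
  have hge : 0 ≤ m τ := by
    have hct : ContinuousWithinAt m (Iio τ) τ :=
      ((hmc τ hτ0.le).continuousAt (Ici_mem_nhds hτ0)).continuousWithinAt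
    refine ge_of_tendsto hct ?_
    filter_upwards [Ioo_mem_nhdsLT hτ0] with s hs using (hbefore s hs.1.le hs.2).le
  have hmz : m τ = 0 := le_antisymm hτZ.2 hge
  -- At the first zero τ of the minimum, the function that vanishes was positive just before, so its
  -- left difference quotients are nonpositive, against a positive derivative.
  have hleft : ∀ g g' : ℝ → ℝ, HasDerivAt g (g' τ) τ → g τ = 0 → 0 < g' τ →
      (∀ s, 0 ≤ s → s < τ → 0 < g s) → False := by
    intro g g' hg hg0 hg' hpos
    have hsl := hg.hasDerivWithinAt (s := Iio τ)
    rw [hasDerivWithinAt_iff_tendsto_slope' (by simp)] at hsl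
    have hev := (hsl.eventually (lt_mem_nhds hg')).and (Ioo_mem_nhdsLT hτ0)
    obtain ⟨s, hs1, hs2⟩ := hev.exists
    rw [slope_def_field, hg0, sub_zero] at hs1
    exact absurd hs1 (not_lt.2 (div_nonpos_of_nonneg_of_nonpos (hpos s hs2.1.le hs2.2).le
      (by linarith [hs2.2])))
  have hg1 : 0 ≤ g₁ τ := hge.trans (min_le_left _ _)
  have hg2 : 0 ≤ g₂ τ := hge.trans (min_le_right _ _)
  rcases min_choice (g₁ τ) (g₂ τ) with h | h
  · have hz : g₁ τ = 0 := h.symm.trans hmz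
    exact hleft g₁ g₁' (hd₁ τ hτ0) hz (hz₁ τ hτ0 hz hg2)
      fun s h0 hs => (hbefore s h0 hs).trans_le (min_le_left _ _)
  · have hz : g₂ τ = 0 := h.symm.trans hmz
    exact hleft g₂ g₂' (hd₂ τ hτ0) hz (hz₂ τ hτ0 hz hg1)
      fun s h0 hs => (hbefore s h0 hs).trans_le (min_le_right _ _)

/-- A differential inequality `g' ≥ c g` forces exponential lower bounds. -/
theorem mul_exp_le_of_mul_le_deriv {g g' : ℝ → ℝ} {a c : ℝ} (hc : ContinuousOn g (Ici a))
    (hd : ∀ s > a, HasDerivAt g (g' s) s) (h : ∀ s > a, c * g s ≤ g' s) :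
    ∀ s ≥ a, g a * Real.exp (c * (s - a)) ≤ g s := by
  have hmono : MonotoneOn (fun s => g s * Real.exp (-c * (s - a))) (Ici a) := by
    have hder : ∀ s > a, HasDerivAt (fun s => g s * Real.exp (-c * (s - a)))
        (g' s * Real.exp (-c * (s - a)) + g s * (Real.exp (-c * (s - a)) * (-c * 1))) s := by
      intro s hs
      exact (hd s hs).mul ((((hasDerivAt_id s).sub_const a).const_mul (-c)).exp)
    refine monotoneOn_of_deriv_nonneg (convex_Ici a)
      (hc.mul (by fun_prop)) (fun s hs => ?_) (fun s hs => ?_)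
    · rw [interior_Ici] at hs
      exact (hder s hs).differentiableAt.differentiableWithinAt
    · rw [interior_Ici] at hs
      rw [(hder s hs).deriv]
      nlinarith [h s hs, Real.exp_pos (-c * (s - a))]
  intro s hs
  have h1 := hmono self_mem_Ici hs hs
  simp only [sub_self, mul_zero, Real.exp_zero, mul_one] at h1
  have h2 : Real.exp (-c * (s - a)) * Real.exp (c * (s - a)) = 1 := by
    rw [← Real.exp_add]; simp
  calc g a * Real.exp (c * (s - a))
      ≤ g s * Real.exp (-c * (s - a)) * Real.exp (c * (s - a)) := by gcongr
    _ = g s := by rw [mul_assoc, h2, mul_one]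

/-! ### The scalar form of the system, with coordinates clamped to a compact interval -/

/-- The retraction of the line onto `[-R, R]`. -/
noncomputable def clamp (R x : ℝ) : ℝ := max (-R) (min R x)

theorem clamp_of_abs_le {R x : ℝ} (h : |x| ≤ R) : clamp R x = x := by
  rw [abs_le] at h
  rw [clamp, min_eq_right h.2, max_eq_right h.1]

theorem clamp_mono {R x y : ℝ} (h : x ≤ y) : clamp R x ≤ clamp R y :=
  max_le_max le_rfl (min_le_min le_rfl h)

theorem abs_clamp_le {R : ℝ} (hR : 0 ≤ R) (x : ℝ) : |clamp R x| ≤ R := by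
  rw [abs_le, clamp]
  exact ⟨le_max_left _ _, max_le (by linarith) (min_le_left _ _)⟩

theorem clamp_sub_clamp_le {R x y : ℝ} (h : x ≤ y) : clamp R y - clamp R x ≤ y - x := by
  unfold clamp
  grind

theorem abs_clamp_sub_clamp_le (R x y : ℝ) : |clamp R x - clamp R y| ≤ |x - y| := by
  unfold clamp
  grind

theorem clamp_nonneg {R x : ℝ} (hR : 0 ≤ R) (hx : 0 ≤ x) : 0 ≤ clamp R x :=
  le_max_of_le_right (le_min hR hx)

theorem clamp_nonpos {R x : ℝ} (hR : 0 ≤ R) (hx : x ≤ 0) : clamp R x ≤ 0 :=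
  max_le (by linarith) ((min_le_right _ _).trans hx)

theorem clamp_le_self {R x : ℝ} (hR : 0 ≤ R) (hx : 0 ≤ x) : clamp R x ≤ x :=
  max_le (by linarith) (min_le_right _ _)

theorem le_clamp_self {R x : ℝ} (hR : 0 ≤ R) (hx : x ≤ 0) : x ≤ clamp R x :=
  le_max_of_le_right (le_min (by linarith) le_rfl)

theorem clamp_pos {R x : ℝ} (hR : 0 < R) (hx : 0 < x) : 0 < clamp R x :=
  lt_max_of_lt_right (lt_min hR hx)

/-- `(x, y)` solves, for `s > 0`, the system with slopes `(k, l)` in which the coordinates are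
clamped to `[-R, R]`. -/
structure ClampSol (R k l : ℝ) (x y : ℝ → ℝ) : Prop where
  cont_fst : ContinuousOn x (Ici 0)
  cont_snd : ContinuousOn y (Ici 0)
  deriv_fst : ∀ s > 0, HasDerivAt x
    ((k - l) * clamp R (x s) + k * clamp R (y s) - clamp R (x s) ^ 2) s
  deriv_snd : ∀ s > 0, HasDerivAt y
    ((l - k) * clamp R (y s) + l * clamp R (x s) - clamp R (y s) ^ 2) s

namespace ClampSol

variable {R k l : ℝ} {x y x' y' : ℝ → ℝ}

theorem swap (h : ClampSol R k l x y) : ClampSol R l k y x :=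
  ⟨h.cont_snd, h.cont_fst, h.deriv_snd, h.deriv_fst⟩

theorem shift (h : ClampSol R k l x y) {T : ℝ} (hT : 0 ≤ T) :
    ClampSol R k l (fun s => x (s + T)) (fun s => y (s + T)) where
  cont_fst := h.cont_fst.comp (by fun_prop) fun s hs => add_nonneg (mem_Ici.1 hs) hT
  cont_snd := h.cont_snd.comp (by fun_prop) fun s hs => add_nonneg (mem_Ici.1 hs) hT
  deriv_fst s hs := (h.deriv_fst (s + T) (by linarith)).comp_add_const s T
  deriv_snd s hs := (h.deriv_snd (s + T) (by linarith)).comp_add_const s T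

theorem zero (hR : 0 ≤ R) : ClampSol R k l (fun _ => 0) (fun _ => 0) := by
  have h0 : clamp R 0 = 0 := clamp_of_abs_le (by simpa using hR)
  constructor
  · exact continuousOn_const
  · exact continuousOn_const
  · intro s _
    simpa [h0] using hasDerivAt_const s (0 : ℝ)
  · intro s _
    simpa [h0] using hasDerivAt_const s (0 : ℝ)

/-! ### Order preservation and invariant quadrants -/

/-- The system is cooperative: solutions preserve the componentwise order. -/
theorem le_of_le (hR : 0 ≤ R) (hk : 0 < k) (hl : 0 < l) (h : ClampSol R k l x y)
    (h' : ClampSol R k l x' y') (hx : x 0 ≤ x' 0) (hy : y 0 ≤ y' 0) :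
    ∀ s ≥ 0, x s ≤ x' s ∧ y s ≤ y' s := by
  -- The term η e^{Ls} makes the comparison strict. Where one perturbed difference first vanishes,
  -- with e the size of the perturbation, the linear terms lose at most 2ke (or 2le) and the square
  -- at most 2Re, which the growth Le exceeds. The coupling terms have the right sign because k and
  -- l are positive. At the end η tends to 0.
  set L : ℝ := 2 * (k + l) + 2 * R + 1 with hL
  have hL0 : 0 < L := by positivity
  have key : ∀ η > 0, ∀ s ≥ 0, 0 < (x' s - x s) + η * Real.exp (L * s) ∧
      0 < (y' s - y s) + η * Real.exp (L * s) := by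
    intro η hη
    have hexp : ∀ s, HasDerivAt (fun s => η * Real.exp (L * s)) (η * (Real.exp (L * s) * L)) s :=
      fun s => by
        simpa using (((hasDerivAt_id s).const_mul L).exp).const_mul η
    have aux : ∀ (k l a b a' b' e : ℝ), 0 < k → 0 < l → 0 < e → L = 2 * (k + l) + 2 * R + 1 →
        (a' - a) + e = 0 → 0 ≤ (b' - b) + e →
        0 < ((k - l) * clamp R a' + k * clamp R b' - clamp R a' ^ 2) -
          ((k - l) * clamp R a + k * clamp R b - clamp R a ^ 2) + e * L := by
      intro k l a b a' b' e hk hl he hLe ha hb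
      have h1 : clamp R a' ≤ clamp R a := clamp_mono (by linarith)
      have h2 : clamp R a - clamp R a' ≤ e := (clamp_sub_clamp_le (by linarith)).trans (by linarith)
      have h3 : clamp R b - clamp R b' ≤ e := by
        rcases le_total b b' with hbb | hbb
        · linarith [clamp_mono (R := R) hbb]
        · exact (clamp_sub_clamp_le hbb).trans (by linarith)
      have h4 := abs_le.1 (abs_clamp_le hR a)
      have h5 := abs_le.1 (abs_clamp_le hR a')
      have h6 : -(k * e) ≤ (k - l) * (clamp R a' - clamp R a) := by
        nlinarith
      have h7 : -(k * e) ≤ k * (clamp R b' - clamp R b) := by nlinarith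
      have h8 : -(2 * R * e) ≤ -(clamp R a' ^ 2 - clamp R a ^ 2) := by
        nlinarith
      rw [hLe]
      nlinarith [mul_pos hl he, mul_pos hk he]
    refine pos_of_deriv_pos_of_eq_zero
      ((h'.cont_fst.sub h.cont_fst).add (by fun_prop))
      ((h'.cont_snd.sub h.cont_snd).add (by fun_prop))
      (fun s hs => ((h'.deriv_fst s hs).sub (h.deriv_fst s hs)).add (hexp s))
      (fun s hs => ((h'.deriv_snd s hs).sub (h.deriv_snd s hs)).add (hexp s))
      (by simp; linarith) (by simp; linarith) (fun s hs h1 h2 => ?_) (fun s hs h1 h2 => ?_)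
    · rw [← mul_assoc]
      exact aux k l _ _ _ _ _ hk hl (by positivity) hL h1 h2
    · rw [← mul_assoc]
      exact aux l k _ _ _ _ _ hl hk (by positivity) (by rw [hL]; ring) h1 h2
  intro s hs
  have hE := Real.exp_pos (L * s)
  constructor
  · refine le_of_forall_pos_le_add fun ε hε => ?_
    have := (key (ε / Real.exp (L * s)) (by positivity) s hs).1
    rw [div_mul_cancel₀ _ hE.ne'] at this
    linarith
  · refine le_of_forall_pos_le_add fun ε hε => ?_
    have := (key (ε / Real.exp (L * s)) (by positivity) s hs).2
    rw [div_mul_cancel₀ _ hE.ne'] at this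
    linarith

/-- The open first quadrant is positively invariant. -/
theorem pos_of_pos (hR : 0 ≤ R) (hk : 0 < k) (hl : 0 < l) (h : ClampSol R k l x y)
    (hx : 0 < x 0) (hy : 0 < y 0) : ∀ s ≥ 0, 0 < x s ∧ 0 < y s := by
  -- The barrier is δ e^{-Ls} in both coordinates. On it a coordinate falls at a rate of at most (l
  -- + R) or (k + R) times its size, slower than the barrier itself.
  set L : ℝ := k + l + R + 1 with hL
  set δ := min (x 0) (y 0) / 2 with hδ
  have hδ0 : 0 < δ := half_pos (lt_min hx hy)
  have hδx : δ < x 0 := (half_lt_self (lt_min hx hy)).trans_le (min_le_left _ _)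
  have hδy : δ < y 0 := (half_lt_self (lt_min hx hy)).trans_le (min_le_right _ _)
  have hexp : ∀ s, HasDerivAt (fun s => δ * Real.exp (-L * s))
      (δ * (Real.exp (-L * s) * -L)) s := fun s => by
    simpa using (((hasDerivAt_id s).const_mul (-L)).exp).const_mul δ
  have aux : ∀ (k l a b e : ℝ), 0 < k → 0 < l → 0 < e → L = k + l + R + 1 →
      a - e = 0 → 0 ≤ b - e →
      0 < (k - l) * clamp R a + k * clamp R b - clamp R a ^ 2 - e * -L := by
    intro k l a b e hk hl he hLe ha hb
    have h1 := clamp_nonneg hR (show 0 ≤ a by linarith)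
    have h2 := clamp_nonneg hR (show 0 ≤ b by linarith)
    have h3 := clamp_le_self hR (show 0 ≤ a by linarith)
    have h4 := (abs_le.1 (abs_clamp_le hR a)).2
    have h5 : clamp R a ^ 2 ≤ R * e := by nlinarith
    have h6 : l * clamp R a ≤ l * e := by nlinarith
    rw [hLe]
    nlinarith [mul_nonneg hk.le h1, mul_nonneg hk.le h2, mul_pos hk he]
  intro s hs
  have := pos_of_deriv_pos_of_eq_zero
    (h.cont_fst.sub (by fun_prop)) (h.cont_snd.sub (by fun_prop))
    (fun s hs => (h.deriv_fst s hs).sub (hexp s)) (fun s hs => (h.deriv_snd s hs).sub (hexp s))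
    (by simpa using hδx) (by simpa using hδy)
    (fun s hs h1 h2 => by
      simp only [← mul_assoc]
      exact aux k l _ _ _ hk hl (by positivity) hL h1 h2)
    (fun s hs h1 h2 => by
      simp only [← mul_assoc]
      exact aux l k _ _ _ hl hk (by positivity) (by rw [hL]; ring) h1 h2) s hs
  have hE : 0 < δ * Real.exp (-L * s) := by positivity
  simp only [Pi.sub_apply] at this
  exact ⟨by linarith, by linarith⟩

/-- The open third quadrant is positively invariant. -/
theorem neg_of_neg (hR : 0 ≤ R) (hk : 0 < k) (hl : 0 < l) (h : ClampSol R k l x y)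
    (hx : x 0 < 0) (hy : y 0 < 0) : ∀ s ≥ 0, x s < 0 ∧ y s < 0 := by
  set L : ℝ := k + l + R + 1 with hL
  set δ := min (-x 0) (-y 0) / 2 with hδ
  have hmin : 0 < min (-x 0) (-y 0) := lt_min (by linarith) (by linarith)
  have hδ0 : 0 < δ := half_pos hmin
  have hδx : δ < -x 0 := (half_lt_self hmin).trans_le (min_le_left _ _)
  have hδy : δ < -y 0 := (half_lt_self hmin).trans_le (min_le_right _ _)
  have hexp : ∀ s, HasDerivAt (fun s => δ * Real.exp (-L * s))
      (δ * (Real.exp (-L * s) * -L)) s := fun s => by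
    simpa using (((hasDerivAt_id s).const_mul (-L)).exp).const_mul δ
  -- In the third quadrant the quadratic term pushes away from the axis, so only the term `l * clamp
  -- R a` has to be absorbed.
  have aux : ∀ (k l a b e : ℝ), 0 < k → 0 < l → 0 < e → L = k + l + R + 1 →
      -a - e = 0 → 0 ≤ -b - e →
      0 < -((k - l) * clamp R a + k * clamp R b - clamp R a ^ 2) - e * -L := by
    intro k l a b e hk hl he hLe ha hb
    have h1 := clamp_nonpos hR (show a ≤ 0 by linarith)
    have h2 := clamp_nonpos hR (show b ≤ 0 by linarith)
    have h3 := le_clamp_self hR (show a ≤ 0 by linarith)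
    have h6 : -(l * clamp R a) ≤ l * e := by nlinarith
    rw [hLe]
    nlinarith [mul_nonneg hk.le (neg_nonneg.2 h1), mul_nonneg hk.le (neg_nonneg.2 h2),
      mul_pos hk he, mul_nonneg hR he.le]
  intro s hs
  have := pos_of_deriv_pos_of_eq_zero
    (h.cont_fst.neg.sub (by fun_prop)) (h.cont_snd.neg.sub (by fun_prop))
    (fun s hs => (h.deriv_fst s hs).neg.sub (hexp s))
    (fun s hs => (h.deriv_snd s hs).neg.sub (hexp s))
    (by simpa using hδx) (by simpa using hδy)
    (fun s hs h1 h2 => by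
      simp only [← mul_assoc]
      exact aux k l _ _ _ hk hl (by positivity) hL h1 h2)
    (fun s hs h1 h2 => by
      simp only [← mul_assoc]
      exact aux l k _ _ _ hl hk (by positivity) (by rw [hL]; ring) h1 h2) s hs
  have hE : 0 < δ * Real.exp (-L * s) := by positivity
  simp only [Pi.sub_apply, Pi.neg_apply] at this
  exact ⟨by linarith, by linarith⟩

/-- A solution that vanishes at some time stays at the origin. -/
theorem eq_zero_of_eq_zero (hR : 0 ≤ R) (hk : 0 < k) (hl : 0 < l) (h : ClampSol R k l x y)
    {T : ℝ} (hT : 0 ≤ T) (hx : x T = 0) (hy : y T = 0) : ∀ s ≥ T, x s = 0 ∧ y s = 0 := by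
  intro s hs
  -- Comparison with the zero solution in both directions.
  have h1 := le_of_le hR hk hl (h.shift hT) (ClampSol.zero hR) (by simp [hx]) (by simp [hy])
    (s - T) (by linarith)
  have h2 := le_of_le hR hk hl (ClampSol.zero hR) (h.shift hT) (by simp [hx]) (by simp [hy])
    (s - T) (by linarith)
  simp only [sub_add_cancel] at h1 h2
  exact ⟨le_antisymm h1.1 h2.1, le_antisymm h1.2 h2.2⟩

end ClampSol

/-! ### Logistic barriers and convergence to the equilibrium -/

/-- The solution `(1 + C e^{-cs})⁻¹` of the logistic equation. -/
noncomputable def logistic (c C s : ℝ) : ℝ := (1 + C * Real.exp (-c * s))⁻¹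

theorem hasDerivAt_logistic {c C s : ℝ} (h : 0 < 1 + C * Real.exp (-c * s)) :
    HasDerivAt (logistic c C) (c * (logistic c C s * (1 - logistic c C s))) s := by
  have h1 : HasDerivAt (fun s => 1 + C * Real.exp (-c * s))
      (C * (Real.exp (-c * s) * -c)) s := by
    simpa using ((((hasDerivAt_id s).const_mul (-c)).exp).const_mul C).const_add 1
  refine (h1.inv h.ne').congr_deriv ?_
  have h0 := h.ne'
  unfold logistic
  generalize Real.exp (-c * s) = e at h0 ⊢
  field_simp
  ring

theorem tendsto_logistic {c : ℝ} (hc : 0 < c) (C : ℝ) :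
    Tendsto (logistic c C) atTop (𝓝 1) := by
  have h1 : Tendsto (fun s : ℝ => Real.exp (-c * s)) atTop (𝓝 0) :=
    Real.tendsto_exp_atBot.comp (tendsto_id.const_mul_atTop_of_neg (by linarith))
  have h2 : Tendsto (fun s : ℝ => 1 + C * Real.exp (-c * s)) atTop (𝓝 1) := by
    simpa using (h1.const_mul C).const_add 1
  have := h2.inv₀ one_ne_zero
  rwa [inv_one] at this

namespace ClampSol

variable {R k l : ℝ} {x y x' y' : ℝ → ℝ}

/-- At the point e(k, l) the field is e(1 - e)(k², l²), so along this ray the flow approaches (k, l)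
faster than a point b(s)(k, l) with b' = cb(1 - b), as c < min(k, l). The value C = -1/2 makes b
start at 2 and decrease to 1; the bound on R keeps the clamp inactive at the barrier. -/
theorem lt_logistic (hk : 0 < k) (hl : 0 < l) (hR : 2 * (k + l) ≤ R)
    (h : ClampSol R k l x y) (hx : x 0 < 2 * k) (hy : y 0 < 2 * l) :
    ∀ s ≥ 0, x s < logistic (min k l / 2) (-1 / 2) s * k ∧
      y s < logistic (min k l / 2) (-1 / 2) s * l := by
  set c := min k l / 2 with hc
  have hc0 : 0 < c := half_pos (lt_min hk hl)
  have hck : c < k := (half_lt_self (lt_min hk hl)).trans_le (min_le_left _ _)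
  have hcl : c < l := (half_lt_self (lt_min hk hl)).trans_le (min_le_right _ _)
  have hexp : ∀ s ≥ 0, 0 < Real.exp (-c * s) ∧ Real.exp (-c * s) ≤ 1 := fun s hs =>
    ⟨Real.exp_pos _, Real.exp_le_one_iff.2 (by nlinarith [mul_nonneg hc0.le hs])⟩
  have hpos : ∀ s ≥ 0, 0 < 1 + -1 / 2 * Real.exp (-c * s) := fun s hs => by
    linarith [(hexp s hs).2]
  set b := logistic c (-1 / 2) with hb
  have hb1 : ∀ s ≥ 0, 1 < b s ∧ b s ≤ 2 := by
    intro s hs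
    constructor
    · exact one_lt_inv_iff₀.2 ⟨hpos s hs, by linarith [(hexp s hs).1]⟩
    · exact inv_le_of_inv_le₀ (by norm_num) (by linarith [(hexp s hs).2])
  have hbd : ∀ s ≥ 0, HasDerivAt b (c * (b s * (1 - b s))) s := fun s hs =>
    hasDerivAt_logistic (hpos s hs)
  have hbc : ContinuousOn b (Ici 0) := fun s hs => (hbd s hs).continuousAt.continuousWithinAt
  have hb0 : b 0 = 2 := by simp [hb, logistic]; norm_num
  have aux : ∀ k l a d e : ℝ, 0 < k → 0 < l → c < k → 2 * (k + l) ≤ R → 1 < e → e ≤ 2 →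
      e * k - a = 0 → 0 ≤ e * l - d →
      0 < c * (e * (1 - e)) * k - ((k - l) * clamp R a + k * clamp R d - clamp R a ^ 2) := by
    intro k l a d e hk hl hck hR he1 he2 ha hd
    have ha' : a = e * k := by linarith
    have h1 : clamp R a = e * k := by
      rw [ha']
      exact clamp_of_abs_le (by rw [abs_of_pos (by positivity)]; nlinarith)
    have h2 : clamp R d ≤ e * l := by
      have : clamp R d ≤ clamp R (e * l) := clamp_mono (by linarith)
      rwa [clamp_of_abs_le (x := e * l) (by rw [abs_of_pos (by positivity)]; nlinarith)] at this
    rw [h1]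
    have h3 : k * clamp R d ≤ k * (e * l) := by gcongr
    have h4 : 0 < k * (e * (e - 1)) * (k - c) :=
      mul_pos (mul_pos hk (mul_pos (by linarith) (by linarith))) (by linarith)
    nlinarith
  intro s hs
  have := pos_of_deriv_pos_of_eq_zero
    ((hbc.mul continuousOn_const).sub h.cont_fst) ((hbc.mul continuousOn_const).sub h.cont_snd)
    (fun s hs => ((hbd s hs.le).mul_const k).sub (h.deriv_fst s hs))
    (fun s hs => ((hbd s hs.le).mul_const l).sub (h.deriv_snd s hs))
    (by simp only [Pi.sub_apply, Pi.mul_apply, hb0]; linarith)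
    (by simp only [Pi.sub_apply, Pi.mul_apply, hb0]; linarith)
    (fun s hs h1 h2 => aux k l _ _ _ hk hl hck hR (hb1 s hs.le).1 (hb1 s hs.le).2 h1 h2)
    (fun s hs h1 h2 => aux l k _ _ _ hl hk hcl (by linarith) (hb1 s hs.le).1 (hb1 s hs.le).2 h1 h2)
    s hs
  simp only [Pi.sub_apply, Pi.mul_apply] at this
  exact ⟨by linarith, by linarith⟩

theorem lt_two_mul (hk : 0 < k) (hl : 0 < l) (hR : 2 * (k + l) ≤ R)
    (h : ClampSol R k l x y) (hx : x 0 < 2 * k) (hy : y 0 < 2 * l) :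
    ∀ s ≥ 0, x s < 2 * k ∧ y s < 2 * l := by
  intro s hs
  have h1 := lt_logistic hk hl hR h hx hy s hs
  have h2 : logistic (min k l / 2) (-1 / 2) s ≤ 2 := by
    have : Real.exp (-(min k l / 2) * s) ≤ 1 :=
      Real.exp_le_one_iff.2 (by nlinarith [mul_nonneg (lt_min hk hl).le hs])
    exact inv_le_of_inv_le₀ (by norm_num) (by linarith)
  exact ⟨h1.1.trans_le (by gcongr), h1.2.trans_le (by gcongr)⟩

/-- The lower counterpart: a barrier b(s)(k, l) with b increasing to 1, again slower than the flow.
-/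
theorem exists_logistic_lt (hk : 0 < k) (hl : 0 < l) (hR : 2 * (k + l) ≤ R)
    (h : ClampSol R k l x y) (hx : 0 < x 0) (hy : 0 < y 0) :
    ∃ C, ∀ s ≥ 0, logistic (min k l / 2) C s * k < x s ∧ logistic (min k l / 2) C s * l < y s := by
  set c := min k l / 2 with hc
  have hc0 : 0 < c := half_pos (lt_min hk hl)
  have hck : c < k := (half_lt_self (lt_min hk hl)).trans_le (min_le_left _ _)
  have hcl : c < l := (half_lt_self (lt_min hk hl)).trans_le (min_le_right _ _)
  -- Large enough for the initial barrier (k, l)/(1 + C) to lie below the starting point.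
  set C := k / x 0 + l / y 0 with hC
  have hC0 : 0 < C := by positivity
  have hpos : ∀ s, 0 < 1 + C * Real.exp (-c * s) := fun s => by positivity
  refine ⟨C, ?_⟩
  set b := logistic c C with hb
  have hb1 : ∀ s, 0 < b s ∧ b s < 1 := by
    intro s
    constructor
    · exact inv_pos.2 (hpos s)
    · exact inv_lt_one_of_one_lt₀ (by linarith [mul_pos hC0 (Real.exp_pos (-c * s))])
  have hbd : ∀ s, HasDerivAt b (c * (b s * (1 - b s))) s := fun s =>
    hasDerivAt_logistic (hpos s)
  have hbc : ContinuousOn b (Ici 0) := fun s hs => (hbd s).continuousAt.continuousWithinAt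
  have hb0 : b 0 = (1 + C)⁻¹ := by simp [hb, logistic]
  have aux : ∀ k l a d e : ℝ, 0 < k → 0 < l → c < k → 2 * (k + l) ≤ R → 0 < e → e < 1 →
      a - e * k = 0 → 0 ≤ d - e * l →
      0 < ((k - l) * clamp R a + k * clamp R d - clamp R a ^ 2) - c * (e * (1 - e)) * k := by
    intro k l a d e hk hl hck hR he1 he2 ha hd
    have ha' : a = e * k := by linarith
    have h1 : clamp R a = e * k := by
      rw [ha']
      exact clamp_of_abs_le (by rw [abs_of_pos (by positivity)]; nlinarith)
    have h2 : e * l ≤ clamp R d := by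
      have : clamp R (e * l) ≤ clamp R d := clamp_mono (by linarith)
      rwa [clamp_of_abs_le (x := e * l) (by rw [abs_of_pos (by positivity)]; nlinarith)] at this
    rw [h1]
    have h3 : k * (e * l) ≤ k * clamp R d := by gcongr
    have h4 : 0 < k * (e * (1 - e)) * (k - c) :=
      mul_pos (mul_pos hk (mul_pos (by linarith) (by linarith))) (by linarith)
    nlinarith
  have hCx : k < (1 + C) * x 0 := by
    have : k / x 0 * x 0 = k := div_mul_cancel₀ _ hx.ne'
    have : 0 < l / y 0 * x 0 := by positivity
    nlinarith
  have hCy : l < (1 + C) * y 0 := by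
    have : l / y 0 * y 0 = l := div_mul_cancel₀ _ hy.ne'
    have : 0 < k / x 0 * y 0 := by positivity
    nlinarith
  intro s hs
  have := pos_of_deriv_pos_of_eq_zero
    (h.cont_fst.sub (hbc.mul continuousOn_const)) (h.cont_snd.sub (hbc.mul continuousOn_const))
    (fun s hs => (h.deriv_fst s hs).sub ((hbd s).mul_const k))
    (fun s hs => (h.deriv_snd s hs).sub ((hbd s).mul_const l))
    (by
      simp only [Pi.sub_apply, Pi.mul_apply, hb0, sub_pos]
      rwa [inv_mul_lt_iff₀ (by positivity)])
    (by
      simp only [Pi.sub_apply, Pi.mul_apply, hb0, sub_pos]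
      rwa [inv_mul_lt_iff₀ (by positivity)])
    (fun s hs h1 h2 => aux k l _ _ _ hk hl hck hR (hb1 s).1 (hb1 s).2 h1 h2)
    (fun s hs h1 h2 => aux l k _ _ _ hl hk hcl (by linarith) (hb1 s).1 (hb1 s).2 h1 h2)
    s hs
  simp only [Pi.sub_apply, Pi.mul_apply] at this
  exact ⟨by linarith, by linarith⟩

/-- Solutions that reach the open first quadrant converge to the equilibrium `(k, l)`. -/
theorem tendsto_of_pos (hk : 0 < k) (hl : 0 < l) (hR : 2 * (k + l) ≤ R)
    (h : ClampSol R k l x y) (hx : x 0 < 2 * k) (hy : y 0 < 2 * l) {T : ℝ} (hT : 0 ≤ T)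
    (hxT : 0 < x T) (hyT : 0 < y T) :
    Tendsto x atTop (𝓝 k) ∧ Tendsto y atTop (𝓝 l) := by
  have hup := lt_logistic hk hl hR h hx hy
  obtain ⟨C, hC⟩ := exists_logistic_lt hk hl hR (h.shift hT) (by simpa using hxT)
    (by simpa using hyT)
  have hlow : ∀ s ≥ T, logistic (min k l / 2) C (s - T) * k ≤ x s ∧
      logistic (min k l / 2) C (s - T) * l ≤ y s := by
    intro s hs
    have := hC (s - T) (by linarith)
    simp only [sub_add_cancel] at this
    exact ⟨this.1.le, this.2.le⟩
  have hc0 : 0 < min k l / 2 := half_pos (lt_min hk hl)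
  have hsh : Tendsto (fun s : ℝ => s - T) atTop atTop := tendsto_atTop_add_const_right _ _ tendsto_id
  have t1 := tendsto_logistic hc0 (-1 / 2)
  have t2 := (tendsto_logistic hc0 C).comp hsh
  constructor
  · refine tendsto_of_tendsto_of_tendsto_of_le_of_le' (by simpa using t2.mul_const k)
      (by simpa using t1.mul_const k) ?_ ?_
    · filter_upwards [eventually_ge_atTop T] with s hs using (hlow s hs).1
    · filter_upwards [eventually_ge_atTop 0] with s hs using (hup s hs).1.le
  · refine tendsto_of_tendsto_of_tendsto_of_le_of_le' (by simpa using t2.mul_const l)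
      (by simpa using t1.mul_const l) ?_ ?_
    · filter_upwards [eventually_ge_atTop T] with s hs using (hlow s hs).2
    · filter_upwards [eventually_ge_atTop 0] with s hs using (hup s hs).2.le

/-! ### Solutions that avoid both invariant quadrants -/

/-- A solution that avoids the open first and third quadrants stays in one of the closed second
and fourth quadrants. -/
theorem quadrant_of_avoid (hR : 0 ≤ R) (hk : 0 < k) (hl : 0 < l) (h : ClampSol R k l x y)
    (hS : ∀ s ≥ 0, ¬(0 < x s ∧ 0 < y s) ∧ ¬(x s < 0 ∧ y s < 0)) :
    (∀ s ≥ 0, x s ≤ 0 ∧ 0 ≤ y s) ∨ (∀ s ≥ 0, y s ≤ 0 ∧ 0 ≤ x s) := by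
  by_contra! hcon
  obtain ⟨⟨s₁, hs₁, h₁⟩, ⟨s₂, hs₂, h₂⟩⟩ := hcon
  -- Off the two open quadrants the sign of x - y tells the second quadrant from the fourth. A
  -- change of sign forces x = y, hence x = y = 0, at some time, and from then on the solution
  -- rests, which contradicts the later of the two witnesses.
  have hd : ContinuousOn (fun s => x s - y s) (Ici 0) := h.cont_fst.sub h.cont_snd
  have hd1 : 0 < x s₁ - y s₁ := by
    by_contra! hle
    grind [hS s₁ hs₁]
  have hd2 : x s₂ - y s₂ < 0 := by
    by_contra! hle
    grind [hS s₂ hs₂]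
  have hsub : uIcc s₁ s₂ ⊆ Ici 0 := fun s hs => (le_min hs₁ hs₂).trans hs.1
  obtain ⟨τ, hτ, hτ0⟩ := intermediate_value_uIcc (hd.mono hsub)
    (show (0 : ℝ) ∈ uIcc (x s₁ - y s₁) (x s₂ - y s₂) from by
      rw [uIcc_of_ge (by linarith)]; exact ⟨hd2.le, hd1.le⟩)
  have hτ' : 0 ≤ τ := hsub hτ
  have hx0 : x τ = 0 ∧ y τ = 0 := by
    simp only at hτ0
    grind [hS τ hτ']
  have hz := eq_zero_of_eq_zero hR hk hl h hτ' hx0.1 hx0.2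
  rcases le_total s₁ s₂ with hle | hle
  · rw [uIcc_of_le hle] at hτ
    have := hz s₂ hτ.2
    linarith
  · rw [uIcc_of_ge hle] at hτ
    have := hz s₁ hτ.2
    linarith

/-- V = -lx + ky is a Lyapunov function. The cross terms cancel and V' = l²x - k²y + lx² - ky², so
the linear part loses at least mV, and below the level m²/2 one has |x| ≤ m/2, so the term lx² costs
at most half of that. -/
theorem decay_of_second_quadrant {m : ℝ} (hm : 0 < m) (hmk : m ≤ k) (hml : m ≤ l)
    (hmR : m ≤ R) (h : ClampSol R k l x y) (hQ : ∀ s ≥ 0, x s ≤ 0 ∧ 0 ≤ y s)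
    (h0 : -(l * x 0) + k * y 0 < m ^ 2 / 2) :
    ∀ s ≥ 0, -(l * x s) + k * y s ≤ (-(l * x 0) + k * y 0) * Real.exp (-(m / 2) * s) := by
  have hd : ∀ s > 0, HasDerivAt (fun s => -(l * x s) + k * y s) _ s := fun s hs =>
    ((h.deriv_fst s hs).const_mul l).neg.add ((h.deriv_snd s hs).const_mul k)
  have hc : ContinuousOn (fun s => -(l * x s) + k * y s) (Ici 0) :=
    (h.cont_fst.const_mul l).neg.add (h.cont_snd.const_mul k)
  have aux : ∀ a b : ℝ, a ≤ 0 → 0 ≤ b → -(l * a) + k * b ≤ m ^ 2 / 2 →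
      -(l * ((k - l) * clamp R a + k * clamp R b - clamp R a ^ 2)) +
        k * ((l - k) * clamp R b + l * clamp R a - clamp R b ^ 2) ≤
      -(m / 2) * (-(l * a) + k * b) := by
    intro a b ha hb hV
    have hk : 0 < k := hm.trans_le hmk
    have hl : 0 < l := hm.trans_le hml
    have hkb : 0 ≤ k * b := by positivity
    have hla : 0 ≤ l * -a := mul_nonneg hl.le (by linarith)
    have ham : -a ≤ m / 2 := by
      by_contra! hlt
      nlinarith
    have hbm : b ≤ m / 2 := by
      by_contra! hlt
      nlinarith
    rw [clamp_of_abs_le (x := a) (by rw [abs_of_nonpos ha]; linarith),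
      clamp_of_abs_le (x := b) (by rw [abs_of_nonneg hb]; linarith)]
    have e1 : 0 ≤ (l * -a) * (l - m / 2 + a) := mul_nonneg hla (by linarith)
    have e2 : 0 ≤ (k * b) * (k - m / 2 + b) := mul_nonneg hkb (by linarith)
    nlinarith
  -- V cannot climb to the level m²/2, since it would be strictly decreasing there. The two-function
  -- lemma is used with both functions equal.
  have hlt : ∀ s ≥ 0, 0 < m ^ 2 / 2 - (-(l * x s) + k * y s) := by
    intro s hs
    refine (pos_of_deriv_pos_of_eq_zero (continuousOn_const.sub hc) (continuousOn_const.sub hc)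
      (fun s hs => (hd s hs).const_sub _) (fun s hs => (hd s hs).const_sub _)
      (sub_pos.2 h0) (sub_pos.2 h0) ?_ ?_ s hs).1 <;>
    · intro s hs h1 _
      simp only [Pi.sub_apply] at h1
      have := aux _ _ (hQ s hs.le).1 (hQ s hs.le).2 (by linarith)
      rw [← sub_eq_zero.1 h1] at this
      nlinarith [pow_pos hm 3]
  intro s hs
  have := mul_exp_le_of_mul_le_deriv (c := -(m / 2)) hc.neg (fun s hs => (hd s hs).neg)
    (fun s hs => by
      have := aux _ _ (hQ s (le_of_lt hs)).1 (hQ s (le_of_lt hs)).2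
        (by linarith [hlt s (le_of_lt hs)])
      simp only [Pi.neg_apply]
      linarith) s hs
  simp only [Pi.neg_apply, sub_zero] at this
  linarith

/-- A small solution that avoids the open first and third quadrants decays exponentially. -/
theorem decay_of_avoid {m : ℝ} (hm : 0 < m) (hmk : m ≤ k) (hml : m ≤ l) (hmR : m ≤ R)
    (h : ClampSol R k l x y)
    (hS : ∀ s ≥ 0, ¬(0 < x s ∧ 0 < y s) ∧ ¬(x s < 0 ∧ y s < 0))
    (h0 : l * |x 0| + k * |y 0| < m ^ 2 / 2) :
    ∀ s ≥ 0, l * |x s| + k * |y s| ≤ (l * |x 0| + k * |y 0|) * Real.exp (-(m / 2) * s) := by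
  rcases quadrant_of_avoid (hm.le.trans hmR) (hm.trans_le hmk) (hm.trans_le hml) h hS with hQ | hQ
  · have e : ∀ s ≥ 0, l * |x s| + k * |y s| = -(l * x s) + k * y s := fun s hs => by
      rw [abs_of_nonpos (hQ s hs).1, abs_of_nonneg (hQ s hs).2]; ring
    intro s hs
    rw [e 0 le_rfl] at h0 ⊢
    rw [e s hs]
    exact decay_of_second_quadrant hm hmk hml hmR h hQ h0 s hs
  · have e : ∀ s ≥ 0, l * |x s| + k * |y s| = -(k * y s) + l * x s := fun s hs => by
      rw [abs_of_nonneg (hQ s hs).2, abs_of_nonpos (hQ s hs).1]; ring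
    intro s hs
    rw [e 0 le_rfl] at h0 ⊢
    rw [e s hs]
    exact decay_of_second_quadrant hm hml hmk hmR h.swap hQ h0 s hs

theorem abs_le_of_decay {m k l a b N E : ℝ} (hm : 0 < m) (hmk : m ≤ k) (hml : m ≤ l)
    (hN : N < m ^ 2 / 2) (hN0 : 0 ≤ N) (hE : E ≤ 1)
    (h : l * |a| + k * |b| ≤ N * E) : |a| ≤ m / 2 ∧ |b| ≤ m / 2 := by
  have h1 : l * |a| + k * |b| ≤ N := h.trans (mul_le_of_le_one_right hN0 hE)
  have ha := abs_nonneg a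
  have hb := abs_nonneg b
  have hla : m * |a| ≤ l * |a| := by gcongr
  have hkb : m * |b| ≤ k * |b| := by gcongr
  constructor
  · by_contra! hlt
    nlinarith
  · by_contra! hlt
    nlinarith

/-- Quadratic estimate of the unstable coordinate of a point on the stable curve. -/
theorem unstable_coord_of_avoid {m lam w : ℝ} (hm : 0 < m) (hmk : m ≤ k) (hml : m ≤ l)
    (hmR : m ≤ R) (hlam : 0 < lam) (hlam2 : lam ^ 2 = k ^ 2 - k * l + l ^ 2)
    (hw : w = lam - k + l) (hw0 : 0 < w) (h : ClampSol R k l x y)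
    (hS : ∀ s ≥ 0, ¬(0 < x s ∧ 0 < y s) ∧ ¬(x s < 0 ∧ y s < 0))
    (h0 : l * |x 0| + k * |y 0| < m ^ 2 / 2) :
    0 ≤ l * x 0 + w * y 0 ∧
      l * x 0 + w * y 0 ≤ (1 / l + w / k ^ 2) / lam * (l * |x 0| + k * |y 0|) ^ 2 := by
  have hk : 0 < k := hm.trans_le hmk
  have hl : 0 < l := hm.trans_le hml
  set N := l * |x 0| + k * |y 0| with hN
  have hN0 : 0 ≤ N := by positivity
  have hdec := decay_of_avoid hm hmk hml hmR h hS h0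
  have hE : ∀ s ≥ 0, Real.exp (-(m / 2) * s) ≤ 1 := fun s hs =>
    Real.exp_le_one_iff.2 (by nlinarith [mul_nonneg hm.le hs])
  have hbd : ∀ s ≥ 0, |x s| ≤ R ∧ |y s| ≤ R := fun s hs => by
    have := abs_le_of_decay hm hmk hml h0 hN0 (hE s hs) (hdec s hs)
    exact ⟨by linarith, by linarith⟩
  -- (l, w) is the left eigenvector of the linear part for the eigenvalue λ, so z = lx + wy
  -- satisfies z' = λz - (lx² + wy²). As z tends to 0, z(0) is formally ∫ e^{-λs}(lx² + wy²) ds,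
  -- whence both bounds.
  have hd : ∀ s > 0, HasDerivAt (fun s => l * x s + w * y s)
      (lam * (l * x s + w * y s) - (l * x s ^ 2 + w * y s ^ 2)) s := by
    intro s hs
    refine (((h.deriv_fst s hs).const_mul l).add ((h.deriv_snd s hs).const_mul w)).congr_deriv ?_
    rw [clamp_of_abs_le (hbd s hs.le).1, clamp_of_abs_le (hbd s hs.le).2, hw]
    linear_combination (-(y s)) * hlam2
  have hc : ContinuousOn (fun s => l * x s + w * y s) (Ici 0) :=
    (h.cont_fst.const_mul l).add (h.cont_snd.const_mul w)
  have hN1 : ∀ s ≥ 0, l * |x s| + k * |y s| ≤ N := fun s hs =>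
    (hdec s hs).trans (mul_le_of_le_one_right hN0 (hE s hs))
  -- Both l|x| and k|y| are at most N; the constant converts their squares into lx² and wy².
  have hq : ∀ s ≥ 0, l * x s ^ 2 + w * y s ^ 2 ≤ (1 / l + w / k ^ 2) * N ^ 2 := by
    intro s hs
    have hx : (l * |x s|) ^ 2 ≤ N ^ 2 := by
      have := hN1 s hs
      have : 0 ≤ k * |y s| := by positivity
      gcongr
      linarith
    have hy : (k * |y s|) ^ 2 ≤ N ^ 2 := by
      have := hN1 s hs
      have : 0 ≤ l * |x s| := by positivity
      gcongr
      linarith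
    rw [mul_pow, sq_abs] at hx hy
    have e1 : l * x s ^ 2 = 1 / l * (l ^ 2 * x s ^ 2) := by field_simp
    have e2 : w * y s ^ 2 = w / k ^ 2 * (k ^ 2 * y s ^ 2) := by field_simp
    rw [e1, e2, add_mul]
    gcongr
  have hexp0 : Tendsto (fun s => N * Real.exp (-(m / 2) * s)) atTop (𝓝 0) := by
    simpa using (Real.tendsto_exp_atBot.comp
      (tendsto_id.const_mul_atTop_of_neg (show -(m / 2) < 0 by linarith))).const_mul N
  have hlim : Tendsto (fun s => l * x s + w * y s) atTop (𝓝 0) := by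
    have hz := hexp0.const_mul (1 + w / k)
    rw [mul_zero] at hz
    refine squeeze_zero_norm' ?_ hz
    filter_upwards [eventually_ge_atTop 0] with s hs
    have h1 := hdec s hs
    have h2 : w * |y s| = w / k * (k * |y s|) := by field_simp
    have h3 : 0 ≤ l * |x s| := by positivity
    have h4 : 0 ≤ k * |y s| := by positivity
    calc ‖l * x s + w * y s‖ ≤ l * |x s| + w * |y s| := by
          refine (norm_add_le _ _).trans ?_
          rw [norm_mul, norm_mul, Real.norm_of_nonneg hl.le, Real.norm_of_nonneg hw0.le,
            Real.norm_eq_abs, Real.norm_eq_abs]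
      _ ≤ (1 + w / k) * (l * |x s| + k * |y s|) := by
          rw [h2]
          have : 0 ≤ w / k * (l * |x s|) := by positivity
          nlinarith
      _ ≤ (1 + w / k) * (N * Real.exp (-(m / 2) * s)) := by gcongr
  have hge : ∀ s ≥ (0 : ℝ), 1 ≤ Real.exp (lam * (s - 0)) := fun s hs =>
    Real.one_le_exp (by simpa using mul_nonneg hlam.le hs)
  constructor
  -- If z(0) < 0, then -z grows at least like e^{λs} and cannot tend to 0.
  · by_contra! hneg
    have hgr := mul_exp_le_of_mul_le_deriv (c := lam) hc.neg (fun s hs => (hd s hs).neg)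
      (fun s hs => by
        simp only [Pi.neg_apply]
        have : 0 ≤ l * x s ^ 2 + w * y s ^ 2 := by positivity
        linarith)
    have : -(l * x 0 + w * y 0) ≤ 0 := by
      refine ge_of_tendsto (by simpa using hlim.neg) ?_
      filter_upwards [eventually_ge_atTop 0] with s hs
      have h1 := hgr s hs
      simp only [Pi.neg_apply] at h1
      nlinarith [hge s hs]
    linarith
  · by_contra! hlt
    -- D is the level at which λz balances the largest possible quadratic term; above it z - D grows
    -- like e^{λs}.
    set D := (1 / l + w / k ^ 2) / lam * N ^ 2 with hD
    have hDl : lam * D = (1 / l + w / k ^ 2) * N ^ 2 := by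
      rw [hD]; field_simp
    have hD0 : 0 ≤ D := by positivity
    have hgr := mul_exp_le_of_mul_le_deriv (c := lam) (hc.sub continuousOn_const)
      (fun s hs => (hd s hs).sub_const D)
      (fun s hs => by
        simp only [Pi.sub_apply]
        have := hq s (le_of_lt hs)
        linarith)
    have : l * x 0 + w * y 0 - D ≤ 0 - D := by
      refine ge_of_tendsto (hlim.sub_const D) ?_
      filter_upwards [eventually_ge_atTop 0] with s hs
      have h1 := hgr s hs
      simp only [Pi.sub_apply] at h1
      nlinarith [hge s hs]
    linarith

/-- Two distinct ordered solutions do not both tend to the origin. -/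
theorem not_tendsto_zero_of_lt (hR : 0 ≤ R) (hk : 0 < k) (hl : 0 < l) (h : ClampSol R k l x y)
    (h' : ClampSol R k l x' y') (hx : x 0 = x' 0) (hy : y 0 < y' 0)
    (tx : Tendsto x atTop (𝓝 0)) (ty : Tendsto y atTop (𝓝 0))
    (tx' : Tendsto x' atTop (𝓝 0)) (ty' : Tendsto y' atTop (𝓝 0)) : False := by
  have hle := le_of_le hR hk hl h h' hx.le hy.le
  set W : ℝ → ℝ := fun s => (x' s - x s) + (y' s - y s) with hW
  have hd : ∀ s > 0, HasDerivAt W _ s := fun s hs =>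
    ((h'.deriv_fst s hs).sub (h.deriv_fst s hs)).add ((h'.deriv_snd s hs).sub (h.deriv_snd s hs))
  have hc : ContinuousOn W (Ici 0) :=
    (h'.cont_fst.sub h.cont_fst).add (h'.cont_snd.sub h.cont_snd)
  -- In the sum W of the two differences the off-diagonal terms recombine: W' = k Δx + l Δy minus
  -- differences of squares, with Δx, Δy the differences of the clamped coordinates. Far from the
  -- origin this only shows that W stays positive.
  have hgr := mul_exp_le_of_mul_le_deriv (c := -(2 * R)) hc hd (fun s hs => by
    have hs : 0 < s := hs
    have h1 := hle s hs.le
    have aux : ∀ a a' : ℝ, a ≤ a' →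
        0 ≤ clamp R a' - clamp R a ∧
          clamp R a' ^ 2 - clamp R a ^ 2 ≤ 2 * R * (a' - a) := by
      intro a a' haa
      have e1 := clamp_mono (R := R) haa
      have e2 := clamp_sub_clamp_le (R := R) haa
      have e3 := abs_le.1 (abs_clamp_le hR a)
      have e4 := abs_le.1 (abs_clamp_le hR a')
      exact ⟨by linarith, by nlinarith⟩
    have hx1 := aux _ _ h1.1
    have hy1 := aux _ _ h1.2
    simp only [hW]
    nlinarith [mul_nonneg hk.le hx1.1, mul_nonneg hl.le hy1.1])
  set m := min k l with hm
  have hm0 : 0 < m := lt_min hk hl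
  have hmk : m ≤ k := min_le_left _ _
  have hml : m ≤ l := min_le_right _ _
  -- For R = 0 the bound already says that W is nondecreasing; this case is separate because the
  -- neighbourhood below needs a positive radius.
  by_cases hR0 : R = 0
  · subst hR0
    have hWlim : Tendsto W atTop (𝓝 0) := by simpa using (tx'.sub tx).add (ty'.sub ty)
    have hW0 : W 0 ≤ 0 := by
      refine ge_of_tendsto hWlim ?_
      filter_upwards [eventually_ge_atTop 0] with s hs
      simpa using hgr s hs
    simp only [hW] at hW0
    linarith
  have hR' : 0 < R := lt_of_le_of_ne hR (Ne.symm hR0)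
  -- In this neighbourhood the clamp is inactive and squares vary at most m/2 times as fast as the
  -- coordinates, so W' ≥ (m/2)W and the positive W cannot tend to 0.
  set δ := min (m / 4) R with hδ
  have hδ0 : 0 < δ := lt_min (by positivity) hR'
  have hsmall : ∀ f : ℝ → ℝ, Tendsto f atTop (𝓝 0) → ∀ᶠ s in atTop, |f s| ≤ δ := fun f hf => by
    have := hf.abs
    rw [abs_zero] at this
    exact (this.eventually (gt_mem_nhds hδ0)).mono fun s hs => hs.le
  obtain ⟨s₀, hs₀⟩ := eventually_atTop.1 ((hsmall x tx).and ((hsmall y ty).and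
    ((hsmall x' tx').and ((hsmall y' ty').and (eventually_ge_atTop 0)))))
  have hs₀0 : 0 ≤ s₀ := (hs₀ s₀ le_rfl).2.2.2.2
  have hgr2 := mul_exp_le_of_mul_le_deriv (c := m / 2) (a := s₀)
    (hc.mono (Ici_subset_Ici.2 hs₀0)) (fun s hs => hd s (lt_of_le_of_lt hs₀0 hs)) (fun s hs => by
      obtain ⟨b1, b2, b3, b4, hs0⟩ := hs₀ s (le_of_lt hs)
      have hδR : δ ≤ R := min_le_right _ _
      have hδm : δ ≤ m / 4 := min_le_left _ _
      rw [clamp_of_abs_le (b1.trans hδR), clamp_of_abs_le (b2.trans hδR),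
        clamp_of_abs_le (b3.trans hδR), clamp_of_abs_le (b4.trans hδR)]
      have h1 := hle s hs0
      have aux : ∀ a a' : ℝ, a ≤ a' → |a| ≤ δ → |a'| ≤ δ → a' ^ 2 - a ^ 2 ≤ m / 2 * (a' - a) := by
        intro a a' haa ha ha'
        rw [abs_le] at ha ha'
        nlinarith
      have hx1 := aux _ _ h1.1 b1 b3
      have hy1 := aux _ _ h1.2 b2 b4
      simp only [hW]
      nlinarith [mul_nonneg (sub_nonneg.2 hmk) (sub_nonneg.2 h1.1),
        mul_nonneg (sub_nonneg.2 hml) (sub_nonneg.2 h1.2)])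
  have hW0 : 0 < W 0 := by simp only [hW]; linarith
  have hWs : 0 < W s₀ := (by positivity : 0 < W 0 * Real.exp (-(2 * R) * (s₀ - 0))).trans_le
    (hgr s₀ hs₀0)
  have hWlim : Tendsto W atTop (𝓝 0) := by simpa using (tx'.sub tx).add (ty'.sub ty)
  have : W s₀ ≤ 0 := by
    refine ge_of_tendsto hWlim ?_
    filter_upwards [eventually_ge_atTop s₀] with s hs
    have h1 := hgr2 s hs
    have h2 : 1 ≤ Real.exp (m / 2 * (s - s₀)) := Real.one_le_exp (by
      have : 0 ≤ s - s₀ := by linarith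
      positivity)
    nlinarith
  linarith

end ClampSol

/-! ### The stable curve of the system with positive slopes -/

/-- `p` solves the system with slopes `K` on `[0, ∞[`. -/
def ForwardSol (K : Fin 2 → ℝ) (p : ℝ → Fin 2 → ℝ) : Prop :=
  ∀ s ≥ 0, HasDerivWithinAt p (slopeField K (p s)) (Ici 0) s

theorem contDiff_slopeField (K : Fin 2 → ℝ) : ContDiff ℝ 1 (slopeField K) := by
  rw [contDiff_pi]
  intro i
  fin_cases i <;> simp only [slopeField] <;> simp <;> fun_prop

theorem exists_lipschitzOnWith_slopeField (K : Fin 2 → ℝ) (R : ℝ) :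
    ∃ κ, LipschitzOnWith κ (slopeField K) (Metric.closedBall 0 R) :=
  (contDiff_slopeField K).contDiffOn.exists_lipschitzOnWith (by norm_num) (convex_closedBall 0 R)
    (isCompact_closedBall 0 R)

theorem exists_bound_slopeField (K : Fin 2 → ℝ) (R : ℝ) :
    ∃ M, ∀ p ∈ Metric.closedBall (0 : Fin 2 → ℝ) R, ‖slopeField K p‖ ≤ M :=
  (isCompact_closedBall 0 R).exists_bound_of_continuousOn (contDiff_slopeField K).continuous.continuousOn

/-- Clamping the coordinates makes the quadratic field bounded and globally Lipschitz. Solutions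
then exist for all time, and Grönwall's inequality gives continuity in the initial point; solutions
that remain in the box solve the original system. -/
theorem exists_clampFlow (K : Fin 2 → ℝ) {R : ℝ} (hR : 0 ≤ R) :
    ∃ Ψ : (Fin 2 → ℝ) → ℝ → Fin 2 → ℝ, (∀ q, Ψ q 0 = q) ∧
      (∀ q s, HasDerivAt (Ψ q) (slopeField K (fun i => clamp R (Ψ q s i))) s) ∧
      ∀ s ≥ 0, Continuous fun q => Ψ q s := by
  obtain ⟨κ, hκ⟩ := exists_lipschitzOnWith_slopeField K R
  obtain ⟨M, hM⟩ := exists_bound_slopeField K R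
  have hmem : ∀ p : Fin 2 → ℝ, (fun i => clamp R (p i)) ∈ Metric.closedBall (0 : Fin 2 → ℝ) R := by
    intro p
    rw [mem_closedBall_zero_iff, pi_norm_le_iff_of_nonneg hR]
    exact fun i => abs_clamp_le hR _
  have hcl : LipschitzWith 1 fun p : Fin 2 → ℝ => fun i => clamp R (p i) := by
    refine LipschitzWith.of_dist_le_mul fun p q => ?_
    rw [NNReal.coe_one, one_mul, dist_pi_le_iff dist_nonneg]
    exact fun i => (abs_clamp_sub_clamp_le R (p i) (q i)).trans (dist_le_pi_dist p q i)
  have hF : LipschitzWith κ fun p : Fin 2 → ℝ => slopeField K fun i => clamp R (p i) := by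
    have := hκ.comp (hcl.lipschitzOnWith (s := univ)) (fun p _ => hmem p)
    rw [mul_one, lipschitzOnWith_univ] at this
    exact this
  choose Ψ h0 hd using fun q => exists_global_integralCurve hF (fun p => hM _ (hmem p)) q
  refine ⟨Ψ, h0, hd, fun s hs => ?_⟩
  refine LipschitzWith.continuous (K := (Real.exp (κ * s)).toNNReal)
    (LipschitzWith.of_dist_le_mul fun q q' => ?_)
  have := dist_le_of_trajectories_ODE (v := fun _ p => slopeField K fun i => clamp R (p i))
    (a := 0) (b := s) (δ := dist q q') (fun _ => hF)
    (fun t _ => (hd q t).continuousAt.continuousWithinAt) (fun t _ => (hd q t).hasDerivWithinAt)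
    (fun t _ => (hd q' t).continuousAt.continuousWithinAt)
    (fun t _ => (hd q' t).hasDerivWithinAt) (by rw [h0, h0]) s ⟨hs, le_rfl⟩
  rw [Real.coe_toNNReal _ (Real.exp_pos _).le, mul_comm]
  simpa using this

theorem clampSol_of_hasDerivAt {K : Fin 2 → ℝ} {R : ℝ} {p : ℝ → Fin 2 → ℝ}
    (hc : ContinuousOn p (Ici 0))
    (h : ∀ s > 0, HasDerivAt p (slopeField K (fun i => clamp R (p s i))) s) :
    ClampSol R (K 0) (K 1) (fun s => p s 0) (fun s => p s 1) where
  cont_fst := (continuous_apply 0).comp_continuousOn hc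
  cont_snd := (continuous_apply 1).comp_continuousOn hc
  deriv_fst s hs := by simpa [slopeField] using hasDerivAt_pi.1 (h s hs) 0
  deriv_snd s hs := by simpa [slopeField] using hasDerivAt_pi.1 (h s hs) 1

theorem ForwardSol.continuousOn {K : Fin 2 → ℝ} {p : ℝ → Fin 2 → ℝ} (h : ForwardSol K p) :
    ContinuousOn p (Ici 0) := fun s hs => (h s hs).continuousWithinAt

theorem ForwardSol.hasDerivAt {K : Fin 2 → ℝ} {p : ℝ → Fin 2 → ℝ} (h : ForwardSol K p) {s : ℝ}
    (hs : 0 < s) : HasDerivAt p (slopeField K (p s)) s := (h s hs.le).hasDerivAt (Ici_mem_nhds hs)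

theorem ForwardSol.clampSol {K : Fin 2 → ℝ} {R : ℝ} {p : ℝ → Fin 2 → ℝ} (h : ForwardSol K p)
    (hR : ∀ s ≥ 0, ∀ i, |p s i| ≤ R) :
    ClampSol R (K 0) (K 1) (fun s => p s 0) (fun s => p s 1) :=
  clampSol_of_hasDerivAt h.continuousOn fun s hs => by
    have : (fun i => clamp R (p s i)) = p s := funext fun i => clamp_of_abs_le (hR s hs.le i)
    rw [this]
    exact h.hasDerivAt hs

theorem ForwardSol.exists_bound_of_tendsto {K q : Fin 2 → ℝ} {p : ℝ → Fin 2 → ℝ}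
    (h : ForwardSol K p) (hp : Tendsto p atTop (𝓝 q)) : ∃ R ≥ 0, ∀ s ≥ 0, ∀ i, |p s i| ≤ R := by
  obtain ⟨T, hT⟩ := eventually_atTop.1 (hp.norm.eventually (gt_mem_nhds (lt_add_one ‖q‖)))
  obtain ⟨C, hC⟩ := (isCompact_Icc (a := (0 : ℝ)) (b := T)).exists_bound_of_continuousOn
    (h.continuousOn.mono Icc_subset_Ici_self)
  refine ⟨max C (‖q‖ + 1), le_max_of_le_right (by positivity), fun s hs i => ?_⟩
  refine (norm_le_pi_norm (p s) i).trans ?_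
  rcases le_total s T with hsT | hsT
  · exact (hC s ⟨hs, hsT⟩).trans (le_max_left _ _)
  · exact (hT s hsT).le.trans (le_max_right _ _)

/-- Two points on a vertical line do not both lie in the stable set. -/
theorem not_lt_of_mem_stableSet {K q q' : Fin 2 → ℝ} (hK₀ : 0 < K 0) (hK₁ : 0 < K 1)
    (hq : q ∈ stableSet K) (hq' : q' ∈ stableSet K) (h0 : q 0 = q' 0) : ¬ q 1 < q' 1 := by
  intro hlt
  obtain ⟨p, hp0, hp, hpt⟩ := hq
  obtain ⟨p', hp0', hp', hpt'⟩ := hq'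
  obtain ⟨R, hR0, hR⟩ := ForwardSol.exists_bound_of_tendsto hp hpt
  obtain ⟨R', hR0', hR'⟩ := ForwardSol.exists_bound_of_tendsto hp' hpt'
  have t := tendsto_pi_nhds.1 hpt
  have t' := tendsto_pi_nhds.1 hpt'
  exact ClampSol.not_tendsto_zero_of_lt (hR0.trans (le_max_left R R')) hK₀ hK₁
    (ForwardSol.clampSol hp fun s hs i => (hR s hs i).trans (le_max_left _ _))
    (ForwardSol.clampSol hp' fun s hs i => (hR' s hs i).trans (le_max_right _ _))
    (by simpa [hp0, hp0'] using h0) (by simpa [hp0, hp0'] using hlt) (t 0) (t 1) (t' 0) (t' 1)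

theorem eventually_pos_of_hasDerivAt_pos {g : ℝ → ℝ} {d a : ℝ} (hg : HasDerivAt g d a)
    (ha : g a = 0) (hd : 0 < d) : ∀ᶠ s in 𝓝[>] a, 0 < g s := by
  have hsl := hg.hasDerivWithinAt (s := Ioi a)
  rw [hasDerivWithinAt_iff_tendsto_slope' (by simp)] at hsl
  filter_upwards [hsl.eventually (lt_mem_nhds hd), self_mem_nhdsWithin] with s hs hsa
  rw [slope_def_field, ha, sub_zero] at hs
  exact (div_pos_iff_of_pos_right (sub_pos.2 hsa)).1 hs

/-- A curve through the origin that satisfies a quadratic estimate is tangent to a line. -/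
theorem hasDerivAt_zero_of_quadratic {φ : ℝ → ℝ} {k l w D : ℝ} (hk : 0 < k) (hl : 0 < l)
    (hw : 0 < w) (hD : 0 < D) (hc : ContinuousAt φ 0) (h0 : φ 0 = 0)
    (hq : ∀ᶠ a in 𝓝 0, |l * a + w * φ a| ≤ D * (l * |a| + k * |φ a|) ^ 2) :
    HasDerivAt φ (-l / w) 0 := by
  rw [hasDerivAt_iff_isLittleO, Asymptotics.isLittleO_iff]
  intro c hc0
  set c₃ := l + k * (l / w) with hc₃
  have hc₃0 : 0 < c₃ := by positivity
  -- With e the deviation from the line, D N² ≤ D η N and N ≤ c₃|a| + k|e|. The first bound on η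
  -- lets w|e|/2 be absorbed on the left; the second leaves c w|a|/2.
  set η := min (w / (2 * D * k)) (c * w / (2 * D * c₃)) with hη
  have hη0 : 0 < η := lt_min (by positivity) (by positivity)
  have hN : Tendsto (fun a => l * |a| + k * |φ a|) (𝓝 0) (𝓝 0) := by
    have h1 : ContinuousAt (fun a => l * |a| + k * |φ a|) 0 :=
      (continuous_abs.continuousAt.const_mul l).add (hc.abs.const_mul k)
    simpa [ContinuousAt, h0] using h1
  filter_upwards [hq, hN.eventually (gt_mem_nhds hη0)] with a ha1 ha2
  set e := φ a + l * a / w with he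
  have hwe : l * a + w * φ a = w * e := by rw [he]; field_simp; ring
  have hgoal : φ a - φ 0 - (a - 0) • (-l / w) = e := by
    rw [h0, he, smul_eq_mul]; ring
  rw [hgoal, sub_zero, Real.norm_eq_abs, Real.norm_eq_abs]
  rw [hwe, abs_mul, abs_of_pos hw] at ha1
  have hφ : |φ a| ≤ |e| + l / w * |a| := by
    have : φ a = e - l / w * a := by rw [he]; ring
    rw [this]
    refine (abs_sub _ _).trans ?_
    rw [abs_mul, abs_of_pos (by positivity : 0 < l / w)]
  set N := l * |a| + k * |φ a| with hNdef
  have hN0 : 0 ≤ N := by positivity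
  have hN1 : N ≤ c₃ * |a| + k * |e| := by
    have := mul_le_mul_of_nonneg_left hφ hk.le
    rw [hNdef, hc₃]
    linarith
  have hη1 : D * η * k ≤ w / 2 := by
    have : η ≤ w / (2 * D * k) := min_le_left _ _
    rw [le_div_iff₀ (by positivity)] at this
    linarith
  have hη2 : D * η * c₃ ≤ c * w / 2 := by
    have : η ≤ c * w / (2 * D * c₃) := min_le_right _ _
    rw [le_div_iff₀ (by positivity)] at this
    linarith
  have h3 : w * |e| ≤ D * η * N := by
    refine ha1.trans ?_
    rw [sq, mul_assoc]
    gcongr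
  have h4 : D * η * N ≤ D * η * (c₃ * |a| + k * |e|) := by gcongr
  have h5 : D * η * k * |e| ≤ w / 2 * |e| := by gcongr
  have h6 : D * η * c₃ * |a| ≤ c * w / 2 * |a| := by gcongr
  have h7 : w * |e| ≤ w * (c * |a|) := by nlinarith
  exact le_of_mul_le_mul_left h7 hw

/-- The stable direction annihilates the left eigenvector (K₂, w) of the unstable eigenvalue, so its
slope is -K₂/w; the square root in G₋ is λ/K₁. -/
theorem Gminus_slopeRatio_eq {K : Fin 2 → ℝ} (hK₀ : 0 < K 0) {lam w : ℝ}
    (hlam : 0 < lam) (hlam2 : lam ^ 2 = K 0 ^ 2 - K 0 * K 1 + K 1 ^ 2)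
    (hw : w = lam - K 0 + K 1) (hw0 : 0 < w) : Gminus (slopeRatio K) = -K 1 / w := by
  have hs : Real.sqrt (slopeRatio K ^ 2 - slopeRatio K + 1) = lam / K 0 := by
    rw [Real.sqrt_eq_iff_mul_self_eq_of_pos (by positivity), slopeRatio]
    field_simp
    linarith
  rw [Gminus, hs, slopeRatio]
  field_simp
  rw [hw]
  linear_combination (-1 : ℝ) * hlam2

/-- The curve separates the points whose clamped orbit enters the first quadrant (U) from those
whose orbit enters the third (L). The bound R is the same for all starting points, which later
provides a single control set for all the equilibria. -/
theorem exists_stableCurve {K : Fin 2 → ℝ} (hK₀ : 0 < K 0) (hK₁ : 0 < K 1) :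
    ∃ ε > 0, ∃ (φ : ℝ → ℝ) (R : ℝ), ContinuousOn φ (Ioo (-ε) ε) ∧ φ 0 = 0 ∧
      HasDerivAt φ (Gminus (slopeRatio K)) 0 ∧
      (∀ q : Fin 2 → ℝ, ‖q‖ < ε → (q ∈ stableSet K ↔ q 1 = φ (q 0))) ∧
      ∀ q : Fin 2 → ℝ, ‖q‖ < ε → φ (q 0) < q 1 → ∃ p, p 0 = q ∧ ForwardSol K p ∧
        Tendsto p atTop (𝓝 K) ∧ ∀ s ≥ 0, ∀ i, |p s i| ≤ R := by
  set k := K 0 with hk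
  set l := K 1 with hl
  set R : ℝ := 2 * (k + l) with hRdef
  have hR : 0 < R := by positivity
  set m := min k l with hmdef
  have hm : 0 < m := lt_min hK₀ hK₁
  have hmk : m ≤ k := min_le_left _ _
  have hml : m ≤ l := min_le_right _ _
  have hmR : m ≤ R := by linarith
  obtain ⟨Ψ, h0, hd, hΨc⟩ := exists_clampFlow K hR.le
  have hcs : ∀ q, ClampSol R k l (fun s => Ψ q s 0) (fun s => Ψ q s 1) := fun q =>
    clampSol_of_hasDerivAt (fun s _ => (hd q s).continuousAt.continuousWithinAt)
      (fun s _ => hd q s)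
  set U : Set (Fin 2 → ℝ) := {q | ∃ s ≥ 0, 0 < Ψ q s 0 ∧ 0 < Ψ q s 1} with hU
  set L : Set (Fin 2 → ℝ) := {q | ∃ s ≥ 0, Ψ q s 0 < 0 ∧ Ψ q s 1 < 0} with hL
  have hUo : IsOpen U := by
    have : U = ⋃ s ∈ Ici (0 : ℝ), {q | 0 < Ψ q s 0 ∧ 0 < Ψ q s 1} := by
      ext q
      simp only [hU, mem_ofPred_eq, mem_iUnion, mem_Ici, exists_prop, ge_iff_le]
    rw [this]
    refine isOpen_biUnion fun s hs => ?_
    exact (isOpen_lt continuous_const ((continuous_apply 0).comp (hΨc s hs))).inter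
      (isOpen_lt continuous_const ((continuous_apply 1).comp (hΨc s hs)))
  have hLo : IsOpen L := by
    have : L = ⋃ s ∈ Ici (0 : ℝ), {q | Ψ q s 0 < 0 ∧ Ψ q s 1 < 0} := by
      ext q
      simp only [hL, mem_ofPred_eq, mem_iUnion, mem_Ici, exists_prop, ge_iff_le]
    rw [this]
    refine isOpen_biUnion fun s hs => ?_
    exact (isOpen_lt ((continuous_apply 0).comp (hΨc s hs)) continuous_const).inter
      (isOpen_lt ((continuous_apply 1).comp (hΨc s hs)) continuous_const)
  -- By invariance the orbit would lie in both quadrants at time s + t.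
  have hUL : ∀ q, q ∈ U → q ∈ L → False := by
    rintro q ⟨s, hs, hs1, hs2⟩ ⟨t, ht, ht1, ht2⟩
    have a1 := ClampSol.pos_of_pos hR.le hK₀ hK₁ ((hcs q).shift hs) (by simpa using hs1)
      (by simpa using hs2) t ht
    have a2 := ClampSol.neg_of_neg hR.le hK₀ hK₁ ((hcs q).shift ht) (by simpa using ht1)
      (by simpa using ht2) s hs
    simp only [add_comm t s] at a1
    linarith [a1.1, a2.1]
  have hmono : ∀ q q' : Fin 2 → ℝ, q 0 ≤ q' 0 → q 1 ≤ q' 1 → ∀ s ≥ 0,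
      Ψ q s 0 ≤ Ψ q' s 0 ∧ Ψ q s 1 ≤ Ψ q' s 1 := fun q q' e0 e1 =>
    ClampSol.le_of_le hR.le hK₀ hK₁ (hcs q) (hcs q') (by simpa [h0] using e0)
      (by simpa [h0] using e1)
  have hUup : ∀ q q' : Fin 2 → ℝ, q 0 ≤ q' 0 → q 1 ≤ q' 1 → q ∈ U → q' ∈ U := by
    rintro q q' e0 e1 ⟨s, hs, hs1, hs2⟩
    have := hmono q q' e0 e1 s hs
    exact ⟨s, hs, hs1.trans_le this.1, hs2.trans_le this.2⟩
  have hLdown : ∀ q q' : Fin 2 → ℝ, q 0 ≤ q' 0 → q 1 ≤ q' 1 → q' ∈ L → q ∈ L := by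
    rintro q q' e0 e1 ⟨s, hs, hs1, hs2⟩
    have := hmono q q' e0 e1 s hs
    exact ⟨s, hs, this.1.trans_lt hs1, this.2.trans_lt hs2⟩
  have havoid : ∀ q, q ∉ U → q ∉ L → ∀ s ≥ 0, ¬(0 < Ψ q s 0 ∧ 0 < Ψ q s 1) ∧
      ¬(Ψ q s 0 < 0 ∧ Ψ q s 1 < 0) := fun q hqU hqL s hs =>
    ⟨fun hh => hqU ⟨s, hs, hh⟩, fun hh => hqL ⟨s, hs, hh⟩⟩
  have hforward : ∀ q, (∀ s ≥ 0, ∀ i, |Ψ q s i| ≤ R) → ForwardSol K (Ψ q) := by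
    intro q hb s hs
    have : (fun i => clamp R (Ψ q s i)) = Ψ q s := funext fun i => clamp_of_abs_le (hb s hs i)
    have h1 := hd q s
    rw [this] at h1
    exact h1.hasDerivWithinAt
  -- small points that reach neither quadrant belong to the stable set
  have hSb : ∀ q, q ∉ U → q ∉ L → l * |q 0| + k * |q 1| < m ^ 2 / 2 →
      ∀ s ≥ 0, |Ψ q s 0| ≤ m / 2 ∧ |Ψ q s 1| ≤ m / 2 := by
    intro q hqU hqL hq s hs
    have hdec := ClampSol.decay_of_avoid hm hmk hml hmR (hcs q) (havoid q hqU hqL)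
      (by simpa [h0] using hq) s hs
    simp only [h0] at hdec
    exact ClampSol.abs_le_of_decay hm hmk hml hq (by positivity)
      (Real.exp_le_one_iff.2 (by nlinarith [mul_nonneg hm.le hs])) hdec
  have hstable : ∀ q, q ∉ U → q ∉ L → l * |q 0| + k * |q 1| < m ^ 2 / 2 → q ∈ stableSet K := by
    intro q hqU hqL hq
    have hb := hSb q hqU hqL hq
    refine ⟨Ψ q, h0 q, hforward q fun s hs i => ?_, ?_⟩
    · fin_cases i
      · exact (hb s hs).1.trans (by linarith)
      · exact (hb s hs).2.trans (by linarith)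
    · have hdec := ClampSol.decay_of_avoid hm hmk hml hmR (hcs q) (havoid q hqU hqL)
        (by simpa [h0] using hq)
      simp only [h0] at hdec
      have hexp0 : Tendsto (fun s => (l * |q 0| + k * |q 1|) * Real.exp (-(m / 2) * s))
          atTop (𝓝 0) := by
        have := (Real.tendsto_exp_atBot.comp (tendsto_id.const_mul_atTop_of_neg
          (show -(m / 2) < 0 by linarith))).const_mul (l * |q 0| + k * |q 1|)
        rwa [mul_zero] at this
      rw [tendsto_pi_nhds, Fin.forall_fin_two]
      constructor
      · have hz := hexp0.const_mul l⁻¹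
        rw [mul_zero] at hz
        refine squeeze_zero_norm' ?_ hz
        filter_upwards [eventually_ge_atTop 0] with s hs
        rw [inv_mul_eq_div, le_div_iff₀ hK₁, Real.norm_eq_abs]
        have : 0 ≤ k * |Ψ q s 1| := by positivity
        linarith [hdec s hs]
      · have hz := hexp0.const_mul k⁻¹
        rw [mul_zero] at hz
        refine squeeze_zero_norm' ?_ hz
        filter_upwards [eventually_ge_atTop 0] with s hs
        rw [inv_mul_eq_div, le_div_iff₀ hK₀, Real.norm_eq_abs]
        have : 0 ≤ l * |Ψ q s 0| := by positivity
        linarith [hdec s hs]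
  -- the vertical axis
  set B := m ^ 2 / (8 * k) with hB
  have hB0 : 0 < B := by positivity
  have hkB : k * B = m ^ 2 / 8 := by rw [hB]; field_simp
  have hBm : B ≤ m / 8 := by
    rw [hB, div_le_div_iff₀ (by positivity) (by norm_num)]
    nlinarith
  -- On the vertical axis x' = k·clamp(y), so the orbit enters the first quadrant at once from the
  -- upper half, and the third from the lower half.
  have hBU : ![0, B] ∈ U := by
    have hx := hasDerivAt_pi.1 (hd ![0, B] 0) 0
    have hy := hasDerivAt_pi.1 (hd ![0, B] 0) 1
    rw [h0] at hx
    have hz : clamp R 0 = 0 := clamp_of_abs_le (by simpa using hR.le)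
    have e1 := eventually_pos_of_hasDerivAt_pos hx (by simp [h0])
      (by simpa [slopeField, hz] using mul_pos hK₀ (clamp_pos hR hB0))
    have e2 : ∀ᶠ s in 𝓝[>] (0 : ℝ), 0 < Ψ ![0, B] s 1 := by
      refine (hy.continuousAt.eventually (lt_mem_nhds ?_)).filter_mono nhdsWithin_le_nhds
      simpa [h0] using hB0
    obtain ⟨s, ⟨h1, h2⟩, h3⟩ := ((e1.and e2).and self_mem_nhdsWithin).exists
    exact ⟨s, le_of_lt h3, h1, h2⟩
  have hBL : ![0, -B] ∈ L := by
    have hx := hasDerivAt_pi.1 (hd ![0, -B] 0) 0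
    have hy := hasDerivAt_pi.1 (hd ![0, -B] 0) 1
    rw [h0] at hx
    have hz : clamp R 0 = 0 := clamp_of_abs_le (by simpa using hR.le)
    have hBR : clamp R (-B) = -B := clamp_of_abs_le (by rw [abs_neg, abs_of_pos hB0]; linarith)
    have e1 := eventually_pos_of_hasDerivAt_pos hx.neg (by simp [h0])
      (by simpa [slopeField, hz, hBR] using mul_pos hK₀ hB0)
    have e2 : ∀ᶠ s in 𝓝[>] (0 : ℝ), Ψ ![0, -B] s 1 < 0 := by
      refine (hy.continuousAt.eventually (gt_mem_nhds ?_)).filter_mono nhdsWithin_le_nhds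
      simpa [h0] using hB0
    obtain ⟨s, ⟨h1, h2⟩, h3⟩ := ((e1.and e2).and self_mem_nhdsWithin).exists
    exact ⟨s, le_of_lt h3, by simpa using h1, h2⟩
  have hrow : ∀ b : ℝ, Continuous fun a : ℝ => (![a, b] : Fin 2 → ℝ) := fun b => by fun_prop
  have hcol : ∀ a : ℝ, Continuous fun b : ℝ => (![a, b] : Fin 2 → ℝ) := fun a => by fun_prop
  obtain ⟨r₁, hr₁, hr₁U⟩ := Metric.isOpen_iff.1 (hUo.preimage (hrow B)) 0 hBU
  obtain ⟨r₂, hr₂, hr₂L⟩ := Metric.isOpen_iff.1 (hLo.preimage (hrow (-B))) 0 hBL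
  set r := min (min r₁ r₂) (m ^ 2 / (4 * l)) with hr
  have hr0 : 0 < r := lt_min (lt_min hr₁ hr₂) (by positivity)
  have hrU : ∀ a, |a| < r → ![a, B] ∈ U := fun a ha =>
    hr₁U (by simpa using ha.trans_le ((min_le_left _ _).trans (min_le_left _ _)))
  have hrL : ∀ a, |a| < r → ![a, -B] ∈ L := fun a ha =>
    hr₂L (by simpa using ha.trans_le ((min_le_left _ _).trans (min_le_right _ _)))
  have hlr : l * r ≤ m ^ 2 / 4 := by
    have : r ≤ m ^ 2 / (4 * l) := min_le_right _ _
    rw [le_div_iff₀ (by positivity)] at this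
    linarith
  have hNsmall : ∀ a b : ℝ, |a| < r → |b| ≤ B → l * |a| + k * |b| < m ^ 2 / 2 := by
    intro a b ha hb
    have h1 : l * |a| ≤ l * r := by gcongr
    have h2 : k * |b| ≤ k * B := by gcongr
    have : 0 < m ^ 2 := by positivity
    linarith
  have hex : ∀ a, ∃ b, |a| < r → |b| ≤ B ∧ ![a, b] ∉ U ∧ ![a, b] ∉ L := by
    intro a
    by_cases ha : |a| < r
    swap
    · exact ⟨0, fun h => absurd h ha⟩
    by_contra! hcon
    have hcov : Icc (-B) B ⊆ (fun b => (![a, b] : Fin 2 → ℝ)) ⁻¹' L ∪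
        (fun b => (![a, b] : Fin 2 → ℝ)) ⁻¹' U := by
      intro b hb
      by_cases hbU : ![a, b] ∈ U
      · exact Or.inr hbU
      · exact Or.inl ((hcon b).2 (abs_le.2 hb) hbU)
    -- A segment with its ends in the disjoint open sets L and U is not covered by them.
    obtain ⟨b, -, hbL, hbU⟩ := isPreconnected_Icc _ _ (hLo.preimage (hcol a))
      (hUo.preimage (hcol a)) hcov ⟨-B, ⟨le_rfl, by linarith⟩, hrL a ha⟩
      ⟨B, ⟨by linarith, le_rfl⟩, hrU a ha⟩
    exact hUL _ hbU hbL
  choose φ hφ using hex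
  -- The point is not in L, which is closed downwards. Were it outside U as well, it would be a
  -- second stable point on the same vertical line.
  have habove : ∀ a b, |a| < r → |b| ≤ B → φ a < b → ![a, b] ∈ U := by
    intro a b ha hb hlt
    obtain ⟨h1, h2, h3⟩ := hφ a ha
    by_contra hbU
    have hbL : ![a, b] ∉ L := fun hbL => h3 (hLdown _ _ (by simp) (by simpa using hlt.le) hbL)
    exact not_lt_of_mem_stableSet hK₀ hK₁ (hstable _ h2 h3 (by simpa using hNsmall a _ ha h1))
      (hstable _ hbU hbL (by simpa using hNsmall a b ha hb)) (by simp) (by simpa using hlt)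
  have hbelow : ∀ a b, |a| < r → |b| ≤ B → b < φ a → ![a, b] ∈ L := by
    intro a b ha hb hlt
    obtain ⟨h1, h2, h3⟩ := hφ a ha
    by_contra hbL
    have hbU : ![a, b] ∉ U := fun hbU => h2 (hUup _ _ (by simp) (by simpa using hlt.le) hbU)
    exact not_lt_of_mem_stableSet hK₀ hK₁ (hstable _ hbU hbL (by simpa using hNsmall a b ha hb))
      (hstable _ h2 h3 (by simpa using hNsmall a _ ha h1)) (by simp) (by simpa using hlt)
  have hφlt : ∀ a, |a| < r → -B < φ a ∧ φ a < B := by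
    intro a ha
    obtain ⟨h1, h2, h3⟩ := hφ a ha
    rw [abs_le] at h1
    refine ⟨lt_of_le_of_ne h1.1 fun h => h3 ?_, lt_of_le_of_ne h1.2 fun h => h2 ?_⟩
    · rw [← h]; exact hrL a ha
    · rw [h]; exact hrU a ha
  -- A point slightly above the graph lies in the open set U and keeps doing so when a moves, which
  -- bounds φ from above nearby; L bounds it from below.
  have hφcont : ∀ a, |a| < r → ContinuousAt φ a := by
    intro a ha
    have hnear : ∀ᶠ a' in 𝓝 a, |a'| < r := continuous_abs.continuousAt.eventually (gt_mem_nhds ha)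
    refine tendsto_order.2 ⟨fun c hc => ?_, fun c hc => ?_⟩
    · set c' := max c (-B) with hc'
      have hc'φ : c' < φ a := max_lt hc (hφlt a ha).1
      have hmem : ![a, c'] ∈ L := hbelow a c' ha
        (abs_le.2 ⟨le_max_right _ _, (hc'φ.trans (hφlt a ha).2).le⟩) hc'φ
      filter_upwards [hnear, (hLo.preimage (hrow c')).mem_nhds hmem] with a' ha' hm'
      by_contra! hle
      exact (hφ a' ha').2.2 (hLdown ![a', φ a'] ![a', c'] le_rfl
        (hle.trans (le_max_left c (-B))) hm')
    · set c' := min c B with hc'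
      have hc'φ : φ a < c' := lt_min hc (hφlt a ha).2
      have hmem : ![a, c'] ∈ U := habove a c' ha
        (abs_le.2 ⟨((hφlt a ha).1.trans hc'φ).le, min_le_right _ _⟩) hc'φ
      filter_upwards [hnear, (hUo.preimage (hrow c')).mem_nhds hmem] with a' ha' hm'
      by_contra! hle
      exact (hφ a' ha').2.1 (hUup ![a', c'] ![a', φ a'] le_rfl
        ((min_le_left c B).trans hle) hm')
  have hΨ0 : ∀ s ≥ 0, Ψ 0 s 0 = 0 ∧ Ψ 0 s 1 = 0 :=
    ClampSol.eq_zero_of_eq_zero hR.le hK₀ hK₁ (hcs 0) le_rfl (by simp [h0]) (by simp [h0])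
  have hz : (![0, 0] : Fin 2 → ℝ) = 0 := by simp
  have hφ0 : φ 0 = 0 := by
    have hr' : |(0 : ℝ)| < r := by simpa using hr0
    rcases lt_trichotomy (φ 0) 0 with h | h | h
    · have := habove 0 0 hr' (by simpa using hB0.le) h
      rw [hz] at this
      obtain ⟨s, hs, h1, -⟩ := this
      exact absurd (hΨ0 s hs).1 h1.ne'
    · exact h
    · have := hbelow 0 0 hr' (by simpa using hB0.le) h
      rw [hz] at this
      obtain ⟨s, hs, h1, -⟩ := this
      exact absurd (hΨ0 s hs).1 h1.ne
  -- tangent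
  set lam := Real.sqrt (k ^ 2 - k * l + l ^ 2) with hlamdef
  have hrad : 0 < k ^ 2 - k * l + l ^ 2 := by nlinarith [sq_nonneg (k - l), mul_pos hK₀ hK₁]
  have hlam : 0 < lam := Real.sqrt_pos.2 hrad
  have hlam2 : lam ^ 2 = k ^ 2 - k * l + l ^ 2 := Real.sq_sqrt hrad.le
  set w := lam - k + l with hw
  have hw0 : 0 < w := by
    by_contra! hle
    nlinarith [mul_pos hK₀ hK₁]
  have hderiv : HasDerivAt φ (Gminus (slopeRatio K)) 0 := by
    rw [Gminus_slopeRatio_eq hK₀ hlam hlam2 hw hw0]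
    refine hasDerivAt_zero_of_quadratic (k := k) (D := (1 / l + w / k ^ 2) / lam) hK₀ hK₁ hw0
      (by positivity) (hφcont 0 (by simpa using hr0)) hφ0 ?_
    filter_upwards [continuous_abs.continuousAt.eventually
      (gt_mem_nhds (show |(0 : ℝ)| < r by simpa using hr0))] with a ha
    obtain ⟨h1, h2, h3⟩ := hφ a ha
    have := ClampSol.unstable_coord_of_avoid hm hmk hml hmR hlam hlam2 hw hw0 (hcs ![a, φ a])
      (havoid _ h2 h3) (by simpa [h0] using hNsmall a _ ha h1)
    simp only [h0] at this
    change 0 ≤ l * a + w * φ a ∧ _ at this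
    change |l * a + w * φ a| ≤ _
    rw [abs_of_nonneg this.1]
    exact this.2
  have hq2 : ∀ q : Fin 2 → ℝ, q = ![q 0, q 1] := fun q => by
    ext i; fin_cases i <;> rfl
  refine ⟨min r B, lt_min hr0 hB0, φ, R, ?_, hφ0, hderiv, ?_, ?_⟩
  · intro a ha
    exact (hφcont a ((abs_lt.2 ha).trans_le (min_le_left _ _))).continuousWithinAt
  · intro q hq
    have ha : |q 0| < r := (norm_le_pi_norm q 0).trans_lt (hq.trans_le (min_le_left _ _))
    obtain ⟨h1, h2, h3⟩ := hφ _ ha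
    have hmem := hstable _ h2 h3 (by simpa using hNsmall _ _ ha h1)
    constructor
    · intro hqs
      refine le_antisymm (not_lt.1 ?_) (not_lt.1 ?_)
      · simpa using not_lt_of_mem_stableSet hK₀ hK₁ hmem hqs (by simp)
      · simpa using not_lt_of_mem_stableSet hK₀ hK₁ hqs hmem (by simp)
    · intro hqe
      rw [hq2 q, hqe]
      exact hmem
  · intro q hq hlt
    have ha : |q 0| < r := (norm_le_pi_norm q 0).trans_lt (hq.trans_le (min_le_left _ _))
    have hb : |q 1| ≤ B := ((norm_le_pi_norm q 1).trans_lt (hq.trans_le (min_le_right _ _))).le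
    obtain ⟨h1, h2, h3⟩ := hφ _ ha
    have hqU : q ∈ U := by rw [hq2 q]; exact habove _ _ ha hb hlt
    have hlow := hSb _ h2 h3 (by simpa using hNsmall _ _ ha h1)
    have hq0 : q 0 < 2 * k := by
      have hrm : r ≤ m / 4 := by
        refine (min_le_right _ _).trans ?_
        rw [div_le_div_iff₀ (by positivity) (by norm_num)]
        nlinarith
      linarith [(abs_lt.1 ha).2]
    have hq1 : q 1 < 2 * l := by linarith [(abs_le.1 hb).2]
    have hup := ClampSol.lt_two_mul hK₀ hK₁ le_rfl (hcs q) (by simpa [h0] using hq0)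
      (by simpa [h0] using hq1)
    -- Above, the barrier 2K; below, order comparison with the stable orbit through the point of the
    -- curve on the same vertical line.
    have hbound : ∀ s ≥ 0, ∀ i, |Ψ q s i| ≤ R := by
      intro s hs
      have b1 := hup s hs
      have b2 := hmono ![q 0, φ (q 0)] q (by simp) (by simpa using hlt.le) s hs
      have b3 := hlow s hs
      rw [Fin.forall_fin_two, abs_le, abs_le]
      have c1 := (abs_le.1 b3.1).1
      have c2 := (abs_le.1 b3.2).1
      exact ⟨⟨by linarith, by linarith⟩, ⟨by linarith, by linarith⟩⟩
    obtain ⟨T, hT, hT1, hT2⟩ := hqU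
    have hlim := ClampSol.tendsto_of_pos hK₀ hK₁ le_rfl (hcs q) (by simpa [h0] using hq0)
      (by simpa [h0] using hq1) hT hT1 hT2
    exact ⟨Ψ q, h0 q, hforward q hbound, tendsto_pi_nhds.2 (Fin.forall_fin_two.2 hlim), hbound⟩

/-! ### From regular solutions of the Hamilton-Jacobi system to Nash equilibria -/

/-- `u` is a differentiable solution of the Hamilton-Jacobi system with bounded Lipschitz
gradient `P`, for running costs `h` that are bounded from below and grow at most linearly. -/
structure RegularSolution (h P u : Fin 2 → ℝ → ℝ) (R C : ℝ) : Prop where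
  cont : ∀ i, Continuous (h i)
  lower : ∀ i x, -C ≤ h i x
  growth : ∀ i x, |h i x| ≤ C * (1 + |x|)
  lipschitz : ∀ i, ∃ L, LipschitzWith L (P i)
  bound : ∀ i x, |P i x| ≤ R
  deriv : ∀ i x, HasDerivAt (u i) (P i x) x
  eqn : ∀ i x, u i x = h i x - P 0 x * P 1 x - P i x ^ 2 / 2

/-! ### Costs and Carathéodory trajectories -/

theorem LipschitzWith.comp_absolutelyContinuousOnInterval {f g : ℝ → ℝ} {L : NNReal} {a b : ℝ}
    (hf : LipschitzWith L f) (hg : AbsolutelyContinuousOnInterval g a b) :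
    AbsolutelyContinuousOnInterval (fun t => f (g t)) a b := by
  refine squeeze_zero (fun E => Finset.sum_nonneg fun _ _ => dist_nonneg) (fun E => ?_)
    (by simpa using Tendsto.const_mul (L : ℝ) hg)
  rw [Finset.mul_sum]
  exact Finset.sum_le_sum fun _ _ => hf.dist_le_mul _ _

theorem integrableOn_exp_neg_mul_linear (A B : ℝ) :
    IntegrableOn (fun t : ℝ => Real.exp (-t) * (A + B * t)) (Ioi 0) := by
  refine Integrable.mono' (g := fun t => (|A| + 2 * |B|) * Real.exp (-(1 / 2) * t))
    ((exp_neg_integrableOn_Ioi 0 (by norm_num)).const_mul _)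
    (by fun_prop) ?_
  filter_upwards [ae_restrict_mem measurableSet_Ioi] with t ht
  have ht0 : 0 < t := ht
  have h1 : Real.exp (-t) = Real.exp (-(1 / 2) * t) * Real.exp (-(1 / 2) * t) := by
    rw [← Real.exp_add]; ring_nf
  have h2 : Real.exp (-(1 / 2) * t) * Real.exp (t / 2) = 1 := by
    rw [← Real.exp_add]; ring_nf; simp
  have h3 : t / 2 + 1 ≤ Real.exp (t / 2) := Real.add_one_le_exp _
  set e := Real.exp (-(1 / 2) * t) with he
  have he0 : 0 < e := Real.exp_pos _
  have he1 : e ≤ 1 := Real.exp_le_one_iff.2 (by linarith)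
  have h4 : e * t ≤ 2 := by nlinarith
  rw [h1, Real.norm_eq_abs, abs_mul, abs_of_pos (by positivity : 0 < e * e)]
  have h5 : |A + B * t| ≤ |A| + |B| * t := by
    refine (abs_add_le _ _).trans ?_
    rw [abs_mul, abs_of_pos ht0]
  calc e * e * |A + B * t| ≤ e * e * (|A| + |B| * t) := by gcongr
    _ = e * (e * |A| + |B| * (e * t)) := by ring
    _ ≤ e * (1 * |A| + |B| * 2) := by gcongr
    _ = (|A| + 2 * |B|) * e := by ring

theorem cost_eq_coe_integral {h x a : ℝ → ℝ} (hi : IntegrableOn (runningCost h x a) (Ioi 0)) :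
    cost h x a = ((∫ t in Ioi 0, runningCost h x a t : ℝ) : EReal) := by
  have h1 : ∫⁻ t in Ioi 0, ENNReal.ofReal (runningCost h x a t) ≠ ⊤ := hi.lintegral_lt_top.ne
  have h2 : ∫⁻ t in Ioi 0, ENNReal.ofReal (-runningCost h x a t) ≠ ⊤ := hi.neg.lintegral_lt_top.ne
  rw [cost, integral_eq_lintegral_pos_part_sub_lintegral_neg_part hi]
  rw [EReal.coe_sub, EReal.coe_ennreal_toReal h1, EReal.coe_ennreal_toReal h2]

/-- If the negative part of the running cost is dominated, then either the cost is infinite or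
the running cost is integrable. -/
theorem cost_eq_top_or_integrableOn {h x a : ℝ → ℝ}
    (hm : AEStronglyMeasurable (runningCost h x a) (volume.restrict (Ioi 0))) {C : ℝ}
    (hC : ∀ t, -(C * Real.exp (-t)) ≤ runningCost h x a t) :
    cost h x a = ⊤ ∨ IntegrableOn (runningCost h x a) (Ioi 0) := by
  have hexp : IntegrableOn (fun t : ℝ => C * Real.exp (-t)) (Ioi 0) := by
    simpa [IntegrableOn] using (exp_neg_integrableOn_Ioi (0 : ℝ) one_pos).const_mul C
  have h2 : ∫⁻ t in Ioi 0, ENNReal.ofReal (-runningCost h x a t) ≠ ⊤ := by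
    refine ((lintegral_mono fun t => ENNReal.ofReal_le_ofReal ?_).trans_lt
      hexp.lintegral_lt_top).ne
    linarith [hC t]
  by_cases h1 : ∫⁻ t in Ioi 0, ENNReal.ofReal (runningCost h x a t) = ⊤
  · left
    rw [cost, h1, ← EReal.coe_ennreal_toReal h2]
    rfl
  · right
    have hp : IntegrableOn (fun t => max (runningCost h x a t) 0) (Ioi 0) := by
      refine ⟨hm.sup aestronglyMeasurable_const, ?_⟩
      rw [hasFiniteIntegral_iff_ofReal (show 0 ≤ᵐ[volume.restrict (Ioi 0)]
        fun t => max (runningCost h x a t) 0 from Eventually.of_forall fun t => le_max_right _ _)]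
      simpa [ENNReal.ofReal_max] using lt_top_iff_ne_top.2 h1
    have hn : IntegrableOn (fun t => max (-runningCost h x a t) 0) (Ioi 0) := by
      refine ⟨hm.neg.sup aestronglyMeasurable_const, ?_⟩
      rw [hasFiniteIntegral_iff_ofReal (show 0 ≤ᵐ[volume.restrict (Ioi 0)]
        fun t => max (-runningCost h x a t) 0 from Eventually.of_forall fun t => le_max_right _ _)]
      simpa [ENNReal.ofReal_max] using lt_top_iff_ne_top.2 h2
    refine (hp.sub hn).congr (Eventually.of_forall fun t => ?_)
    simp only [Pi.sub_apply]
    grind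

theorem IsCaratheodory.continuousOn {f : ℝ → ℝ → ℝ} {y : ℝ} {x : ℝ → ℝ}
    (hx : IsCaratheodory f y x) : ContinuousOn x (Ici 0) := by
  intro t ht
  have ht : 0 ≤ t := ht
  have := (hx.2.1 (t + 1) (by linarith)).continuousOn
  rw [uIcc_of_le (by linarith)] at this
  refine (this t ⟨ht, by linarith⟩).mono_of_mem_nhdsWithin ?_
  exact mem_of_superset (inter_mem_nhdsWithin _ (Iio_mem_nhds (lt_add_one t)))
    fun s hs => ⟨hs.1, le_of_lt hs.2⟩

theorem IsCaratheodory.ae_hasDerivAt {f : ℝ → ℝ → ℝ} {y : ℝ} {x : ℝ → ℝ}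
    (hx : IsCaratheodory f y x) : ∀ᵐ t, 0 < t → HasDerivAt x (f t (x t)) t :=
  (ae_restrict_iff' measurableSet_Ioi).1 hx.2.2

theorem IsCaratheodory.abs_sub_le {f : ℝ → ℝ → ℝ} {y M : ℝ} {x : ℝ → ℝ}
    (hx : IsCaratheodory f y x) (hf : ∀ t z, |f t z| ≤ M) {T : ℝ} (hT : 0 < T) :
    |x T - y| ≤ M * T := by
  have h1 := (hx.2.1 T hT).integral_deriv_eq_sub
  rw [hx.1] at h1
  rw [← h1]
  have := intervalIntegral.norm_integral_le_of_norm_le_const_ae (a := 0) (b := T)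
    (f := _root_.deriv x) (C := M) (by
      filter_upwards [hx.ae_hasDerivAt] with t ht htm
      rw [uIoc_of_le hT.le] at htm
      rw [(ht htm.1).deriv]
      exact hf _ _)
  simpa [abs_of_pos hT] using this

/-! ### Verification along trajectories -/

namespace RegularSolution

variable {h P u : Fin 2 → ℝ → ℝ} {R C : ℝ}

theorem bound_nonneg (hu : RegularSolution h P u R C) : 0 ≤ R :=
  (abs_nonneg _).trans (hu.bound 0 0)

theorem deriv_eq (hu : RegularSolution h P u R C) (i : Fin 2) : _root_.deriv (u i) = P i :=
  funext fun x => (hu.deriv i x).deriv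

theorem continuous_gradient (hu : RegularSolution h P u R C) (i : Fin 2) : Continuous (P i) :=
  (hu.lipschitz i).choose_spec.continuous

theorem lipschitzWith (hu : RegularSolution h P u R C) (i : Fin 2) :
    LipschitzWith R.toNNReal (u i) :=
  lipschitzWith_of_nnnorm_deriv_le (fun x => (hu.deriv i x).differentiableAt) fun x => by
    rw [hu.deriv_eq, ← NNReal.coe_le_coe, Real.coe_toNNReal _ hu.bound_nonneg]
    exact hu.bound i x

theorem abs_sub_le (hu : RegularSolution h P u R C) (i : Fin 2) (x : ℝ) :
    |u i x - h i x| ≤ 2 * R ^ 2 := by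
  have h0 := hu.bound 0 x
  have h1 := hu.bound 1 x
  have hi := hu.bound i x
  have e1 : |P 0 x * P 1 x| ≤ R ^ 2 := by
    rw [abs_mul, sq]
    gcongr
    exact hu.bound_nonneg
  have e2 : P i x ^ 2 ≤ R ^ 2 := by
    rw [← sq_abs]
    gcongr
  rw [hu.eqn, abs_le]
  rw [abs_le] at e1
  constructor <;> nlinarith [sq_nonneg (P i x)]

theorem isAdmissible (hu : RegularSolution h P u R C) : IsAdmissible h u where
  absCont i a b := (hu.lipschitzWith i).lipschitzOnWith.absolutelyContinuousOnInterval
  eqn := Eventually.of_forall fun x i => ⟨(hu.deriv i x).differentiableAt, by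
    rw [hu.deriv_eq, hu.deriv_eq, hu.deriv_eq]; exact hu.eqn i x⟩
  growth := by
    refine ⟨C + 2 * R ^ 2, fun i x => ?_⟩
    have h1 := hu.abs_sub_le i x
    have h2 := hu.growth i x
    have h3 : |u i x| ≤ |u i x - h i x| + |h i x| := by
      simpa using abs_add_le (u i x - h i x) (h i x)
    nlinarith [mul_nonneg (sq_nonneg R) (abs_nonneg x)]
  jumps y := by
    refine ⟨fun i => P i y, fun i => P i y, fun i => ?_, fun i => ?_, fun hne => (hne rfl).elim⟩
    · rw [hu.deriv_eq]
      exact (hu.continuous_gradient i).continuousAt.mono_left nhdsWithin_le_nhds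
    · rw [hu.deriv_eq]
      exact (hu.continuous_gradient i).continuousAt.mono_left nhdsWithin_le_nhds

theorem feedback_apply (hu : RegularSolution h P u R C) (i : Fin 2) (x : ℝ) :
    feedback u i x = -P i x := by rw [feedback, hu.deriv_eq]

theorem aestronglyMeasurable_runningCost (hu : RegularSolution h P u R C) (i : Fin 2)
    {z a : ℝ → ℝ} (hz : ContinuousOn z (Ici 0)) (ha : AEMeasurable a (volume.restrict (Ioi 0))) :
    AEStronglyMeasurable (runningCost (h i) z a) (volume.restrict (Ioi 0)) := by
  have h1 : AEStronglyMeasurable (fun t => h i (z t)) (volume.restrict (Ioi 0)) :=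
    ((hu.cont i).comp_continuousOn (hz.mono Ioi_subset_Ici_self)).aestronglyMeasurable
      measurableSet_Ioi
  have h2 : AEStronglyMeasurable (fun t : ℝ => Real.exp (-t)) (volume.restrict (Ioi 0)) := by
    fun_prop
  exact h2.mul (h1.add ((ha.pow_const 2).div_const 2).aestronglyMeasurable)

theorem runningCost_lower (hu : RegularSolution h P u R C) (i : Fin 2) (z a : ℝ → ℝ) (t : ℝ) :
    -(C * Real.exp (-t)) ≤ runningCost (h i) z a t := by
  have := hu.lower i (z t)
  have he := Real.exp_pos (-t)
  have : Real.exp (-t) * -C ≤ Real.exp (-t) * (h i (z t) + a t ^ 2 / 2) := by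
    gcongr
    nlinarith [sq_nonneg (a t)]
  rw [runningCost]
  linarith

theorem exists_sol (hu : RegularSolution h P u R C) (y : ℝ) :
    ∃ x, IsCaratheodory (fun _ z => feedback u 0 z + feedback u 1 z) y x := by
  obtain ⟨L₀, hL₀⟩ := hu.lipschitz 0
  obtain ⟨L₁, hL₁⟩ := hu.lipschitz 1
  have hF : LipschitzWith (L₀ + L₁) fun z => -P 0 z + -P 1 z := hL₀.neg.add hL₁.neg
  have hM : ∀ z, ‖-P 0 z + -P 1 z‖ ≤ R + R := fun z => by
    refine (norm_add_le _ _).trans ?_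
    rw [norm_neg, norm_neg]
    exact add_le_add (hu.bound 0 z) (hu.bound 1 z)
  obtain ⟨x, hx0, hx⟩ := exists_global_integralCurve hF hM y
  refine ⟨x, hx0, fun T _ => ?_, Eventually.of_forall fun t => ?_⟩
  · have hlip : LipschitzWith (R + R).toNNReal x :=
      lipschitzWith_of_nnnorm_deriv_le (fun t => (hx t).differentiableAt) fun t => by
        rw [(hx t).deriv, ← NNReal.coe_le_coe, Real.coe_toNNReal _
          (add_nonneg hu.bound_nonneg hu.bound_nonneg)]
        exact hM _
    exact hlip.lipschitzOnWith.absolutelyContinuousOnInterval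
  · simp only [hu.feedback_apply]
    exact hx t

theorem abs_le_of_closedLoop (hu : RegularSolution h P u R C) {y : ℝ} {x : ℝ → ℝ}
    (hx : IsCaratheodory (fun _ z => feedback u 0 z + feedback u 1 z) y x) {t : ℝ} (ht : 0 < t) :
    |x t| ≤ |y| + 2 * R * t := by
  have h1 := hx.abs_sub_le (M := 2 * R) (fun _ z => by
    rw [hu.feedback_apply, hu.feedback_apply]
    refine (abs_add_le _ _).trans ?_
    rw [abs_neg, abs_neg]
    linarith [hu.bound 0 z, hu.bound 1 z]) ht
  have h2 : |x t| ≤ |x t - y| + |y| := by simpa using abs_add_le (x t - y) y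
  linarith

theorem nonneg_const (hu : RegularSolution h P u R C) : 0 ≤ C := by
  simpa using (abs_nonneg _).trans (hu.growth 0 0)

theorem integrableOn_closedLoop (hu : RegularSolution h P u R C) {y : ℝ} {x : ℝ → ℝ}
    (hx : IsCaratheodory (fun _ z => feedback u 0 z + feedback u 1 z) y x) (i : Fin 2) :
    IntegrableOn (runningCost (h i) x fun t => feedback u i (x t)) (Ioi 0) := by
  have hcont : ContinuousOn (fun t => feedback u i (x t)) (Ioi 0) := by
    simp only [hu.feedback_apply]
    exact ((hu.continuous_gradient i).comp_continuousOn
      (hx.continuousOn.mono Ioi_subset_Ici_self)).neg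
  refine Integrable.mono' (integrableOn_exp_neg_mul_linear (C * (1 + |y|) + R ^ 2 / 2) (C * (2 * R)))
    (hu.aestronglyMeasurable_runningCost i hx.continuousOn
      (hcont.aemeasurable measurableSet_Ioi)) ?_
  filter_upwards [ae_restrict_mem measurableSet_Ioi] with t ht
  have h1 := hu.abs_le_of_closedLoop hx ht
  have h2 := hu.growth i (x t)
  have h3 : feedback u i (x t) ^ 2 ≤ R ^ 2 := by
    rw [hu.feedback_apply, neg_sq, ← sq_abs]
    gcongr
    exact hu.bound i _
  rw [runningCost, norm_mul, Real.norm_of_nonneg (Real.exp_pos _).le]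
  gcongr
  rw [Real.norm_eq_abs]
  refine (abs_add_le _ _).trans ?_
  rw [abs_of_nonneg (by positivity : 0 ≤ feedback u i (x t) ^ 2 / 2)]
  nlinarith [hu.nonneg_const]

/-- Derivative of the discounted value function along a trajectory. -/
theorem hasDerivAt_value (hu : RegularSolution h P u R C) (i : Fin 2) {a z : ℝ → ℝ} {t : ℝ}
    (hz : HasDerivAt z (a t + feedback u (1 - i) (z t)) t) :
    HasDerivAt (fun t => Real.exp (-t) * u i (z t))
      (-runningCost (h i) z a t + Real.exp (-t) * ((a t + P i (z t)) ^ 2 / 2)) t := by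
  have h1 : HasDerivAt (fun t : ℝ => Real.exp (-t)) (Real.exp (-t) * -1) t :=
    (hasDerivAt_neg t).exp
  -- Once u_i is replaced through the Hamilton-Jacobi equation, the terms in the opponent's gradient
  -- cancel and the rest completes the square (a + P_i)²/2.
  refine (h1.mul ((hu.deriv i (z t)).comp t hz)).congr_deriv ?_
  have hprod : P i (z t) * P (1 - i) (z t) = P 0 (z t) * P 1 (z t) := by
    fin_cases i
    · rfl
    · exact mul_comm _ _
  rw [hu.feedback_apply, Function.comp_apply, hu.eqn, runningCost]
  linear_combination (-Real.exp (-t)) * hprod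

theorem absolutelyContinuous_value (hu : RegularSolution h P u R C) (i : Fin 2) {z : ℝ → ℝ} {T : ℝ}
    (hz : AbsolutelyContinuousOnInterval z 0 T) :
    AbsolutelyContinuousOnInterval (fun t => Real.exp (-t) * u i (z t)) 0 T := by
  have h1 : AbsolutelyContinuousOnInterval (fun t : ℝ => Real.exp (-t)) 0 T :=
    ContDiffOn.absolutelyContinuousOnInterval (Real.contDiff_exp.comp contDiff_neg).contDiffOn
  exact h1.fun_mul ((hu.lipschitzWith i).comp_absolutelyContinuousOnInterval hz)

theorem integral_deriv_value (hu : RegularSolution h P u R C) (i : Fin 2) {f : ℝ → ℝ → ℝ}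
    {z : ℝ → ℝ} {y T : ℝ} (hz : IsCaratheodory f y z) (hT : 0 < T) :
    ∫ t in (0 : ℝ)..T, _root_.deriv (fun t => Real.exp (-t) * u i (z t)) t =
      Real.exp (-T) * u i (z T) - u i y := by
  rw [(hu.absolutelyContinuous_value i (hz.2.1 T hT)).integral_deriv_eq_sub]
  simp [hz.1]

/-- An arbitrary control has no pointwise bound, so e^{-T} u_i(z(T)) need not obviously vanish at
infinity. If the cost were below u_i(y), this boundary term would stay above some δ > 0 for large T.
But u_i differs from h_i by at most 2R², so the term is dominated by the integrable running cost
plus 2R² e^{-t}. -/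
theorem value_le_integral (hu : RegularSolution h P u R C) (i : Fin 2) {a z : ℝ → ℝ} {y : ℝ}
    (hz : IsCaratheodory (fun t w => a t + feedback u (1 - i) w) y z)
    (hi : IntegrableOn (runningCost (h i) z a) (Ioi 0)) :
    u i y ≤ ∫ t in Ioi 0, runningCost (h i) z a t := by
  by_contra! hlt
  set J := ∫ t in Ioi 0, runningCost (h i) z a t with hJ
  set δ := (u i y - J) / 2 with hδ
  have hδ0 : 0 < δ := by linarith
  have hlim := intervalIntegral_tendsto_integral_Ioi 0 hi tendsto_id
  have hpart : ∀ T > 0, u i y - Real.exp (-T) * u i (z T) ≤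
      ∫ t in (0 : ℝ)..T, runningCost (h i) z a t := by
    intro T hT
    have h1 := hu.integral_deriv_value i hz hT
    have h2 : ∫ t in (0 : ℝ)..T, -_root_.deriv (fun t => Real.exp (-t) * u i (z t)) t ≤
        ∫ t in (0 : ℝ)..T, runningCost (h i) z a t := by
      refine intervalIntegral.integral_mono_ae_restrict hT.le
        (hu.absolutelyContinuous_value i (hz.2.1 T hT)).intervalIntegrable_deriv.neg ?_ ?_
      · rw [intervalIntegrable_iff_integrableOn_Ioc_of_le hT.le]
        exact hi.mono_set Ioc_subset_Ioi_self
      · rw [EventuallyLE, ae_restrict_iff' measurableSet_Icc]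
        filter_upwards [hz.ae_hasDerivAt, compl_mem_ae_iff.2 (measure_singleton (0 : ℝ))]
          with t ht ht0 htm
        have htpos : 0 < t := lt_of_le_of_ne htm.1 (Ne.symm ht0)
        rw [(hu.hasDerivAt_value i (ht htpos)).deriv]
        have : 0 ≤ Real.exp (-t) * ((a t + P i (z t)) ^ 2 / 2) := by positivity
        linarith
    rw [intervalIntegral.integral_neg, h1] at h2
    linarith
  obtain ⟨T₀, hT₀⟩ := eventually_atTop.1
    ((hlim.eventually (gt_mem_nhds (show J < u i y - δ by linarith))).and (eventually_gt_atTop 0))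
  have hT₀0 : 0 < T₀ := (hT₀ T₀ le_rfl).2
  have hexp : IntegrableOn (fun t : ℝ => 2 * R ^ 2 * Real.exp (-t)) (Ioi 0) := by
    simpa [IntegrableOn] using (exp_neg_integrableOn_Ioi (0 : ℝ) one_pos).const_mul (2 * R ^ 2)
  have hsum := (hi.add hexp).mono_set (Ioi_subset_Ioi hT₀0.le)
  -- A positive constant would be integrable on a half-line.
  have hconst : IntegrableOn (fun _ : ℝ => δ) (Ioi T₀) := by
    refine Integrable.mono' hsum aestronglyMeasurable_const ?_
    filter_upwards [ae_restrict_mem measurableSet_Ioi] with t ht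
    have ht' : T₀ < t := ht
    have h1 := hpart t (hT₀0.trans ht')
    have h2 : ∫ t in (0 : ℝ)..t, runningCost (h i) z a t < u i y - δ := (hT₀ t ht'.le).1
    have h3 := (abs_le.1 (hu.abs_sub_le i (z t))).2
    rw [Real.norm_of_nonneg hδ0.le, Pi.add_apply, runningCost]
    have h4 : Real.exp (-t) * u i (z t) ≤
        Real.exp (-t) * (h i (z t) + a t ^ 2 / 2 + 2 * R ^ 2) := by
      gcongr
      nlinarith [sq_nonneg (a t)]
    linarith
  rw [integrableOn_const_iff] at hconst
  simp [hδ0.ne'] at hconst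

/-- For the feedback the completed square vanishes, so the value identity is an equality. The state
grows at most linearly, because the gradient is bounded, and so the discounted boundary term tends
to 0. -/
theorem integral_closedLoop (hu : RegularSolution h P u R C) {y : ℝ} {x : ℝ → ℝ}
    (hx : IsCaratheodory (fun _ z => feedback u 0 z + feedback u 1 z) y x) (i : Fin 2) :
    ∫ t in Ioi 0, runningCost (h i) x (fun t => feedback u i (x t)) t = u i y := by
  have hi := hu.integrableOn_closedLoop hx i
  have hlim := intervalIntegral_tendsto_integral_Ioi 0 hi tendsto_id
  have hsum : ∀ w, feedback u i w + feedback u (1 - i) w = feedback u 0 w + feedback u 1 w := by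
    intro w
    fin_cases i
    · rfl
    · exact add_comm _ _
  have hpart : ∀ T > 0, ∫ t in (0 : ℝ)..T, runningCost (h i) x (fun t => feedback u i (x t)) t =
      u i y - Real.exp (-T) * u i (x T) := by
    intro T hT
    have h1 := hu.integral_deriv_value i hx hT
    have h2 : ∫ t in (0 : ℝ)..T, runningCost (h i) x (fun t => feedback u i (x t)) t =
        ∫ t in (0 : ℝ)..T, -_root_.deriv (fun t => Real.exp (-t) * u i (x t)) t := by
      refine intervalIntegral.integral_congr_ae ?_
      filter_upwards [hx.ae_hasDerivAt] with t ht htm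
      rw [uIoc_of_le hT.le] at htm
      have hd := ht htm.1
      rw [← hsum (x t)] at hd
      rw [(hu.hasDerivAt_value (a := fun t => feedback u i (x t)) i hd).deriv, hu.feedback_apply]
      ring
    rw [h2, intervalIntegral.integral_neg, h1]
    ring
  have hv : Tendsto (fun T => Real.exp (-T) * u i (x T)) atTop (𝓝 0) := by
    set A := C * (1 + |y|) + 2 * R ^ 2 with hA
    set B := C * (2 * R) with hB
    have hz : Tendsto (fun T : ℝ => A * Real.exp (-T) + B * (T ^ 1 * Real.exp (-T))) atTop
        (𝓝 0) := by
      have := ((Real.tendsto_pow_mul_exp_neg_atTop_nhds_zero 0).const_mul A).add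
        ((Real.tendsto_pow_mul_exp_neg_atTop_nhds_zero 1).const_mul B)
      simpa using this
    refine squeeze_zero_norm' ?_ hz
    filter_upwards [eventually_gt_atTop 0] with T hT
    have h1 := hu.abs_le_of_closedLoop hx hT
    have h2 := hu.growth i (x T)
    have h3 := hu.abs_sub_le i (x T)
    have h4 : |u i (x T)| ≤ |u i (x T) - h i (x T)| + |h i (x T)| := by
      simpa using abs_add_le (u i (x T) - h i (x T)) (h i (x T))
    have h5 : C * |x T| ≤ C * (|y| + 2 * R * T) := mul_le_mul_of_nonneg_left h1 hu.nonneg_const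
    rw [norm_mul, Real.norm_of_nonneg (Real.exp_pos _).le, Real.norm_eq_abs, pow_one]
    have h6 : |u i (x T)| ≤ A + B * T := by
      rw [hA, hB]; linarith
    calc Real.exp (-T) * |u i (x T)| ≤ Real.exp (-T) * (A + B * T) := by gcongr
      _ = A * Real.exp (-T) + B * (T * Real.exp (-T)) := by ring
  refine tendsto_nhds_unique hlim ?_
  have : Tendsto (fun T => u i y - Real.exp (-T) * u i (x T)) atTop (𝓝 (u i y)) := by
    simpa using hv.const_sub (u i y)
  refine this.congr' ?_
  filter_upwards [eventually_gt_atTop 0] with T hT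
  exact (hpart T hT).symm

theorem isNash (hu : RegularSolution h P u R C) {A : Fin 2 → Set ℝ}
    (hA : ∀ i x, feedback u i x ∈ A i) : IsNash A h (feedback u) where
  measurable i := by
    have : feedback u i = fun x => -P i x := funext fun x => hu.feedback_apply i x
    rw [this]
    exact (hu.continuous_gradient i).neg.measurable
  mem := hA
  exists_sol := hu.exists_sol
  finite_cost y x hx i := hu.integrableOn_closedLoop hx i
  optimal y x hx i a z ha _ hz := by
    rw [cost_eq_coe_integral (hu.integrableOn_closedLoop hx i), hu.integral_closedLoop hx i]
    rcases cost_eq_top_or_integrableOn (hu.aestronglyMeasurable_runningCost i hz.continuousOn ha)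
      (hu.runningCost_lower i z a) with htop | hint
    · rw [htop]; exact le_top
    · rw [cost_eq_coe_integral hint]
      exact EReal.coe_le_coe_iff.2 (hu.value_le_integral i hz hint)

end RegularSolution

/-! ### Two-sided trajectories -/

/-- Every term is of degree two in (K, p) jointly. Hence -p(-s) solves the system for -K whenever p
solves it for K, and the past of the negative system becomes the future of a system with positive
slopes. -/
theorem slopeField_neg_neg (K p : Fin 2 → ℝ) : slopeField (-K) (-p) = slopeField K p := by
  ext i
  fin_cases i <;> simp [slopeField] <;> ring

theorem slopeField_zero (K : Fin 2 → ℝ) : slopeField K 0 = 0 := by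
  ext i
  fin_cases i <;> simp [slopeField]

/-- At the switching time 0 the one-sided derivative comes from the limit of the derivatives, by
continuity of p and of the field. -/
theorem forwardSol_of_hasDerivAt {K : Fin 2 → ℝ} {p : ℝ → Fin 2 → ℝ} (hc : ContinuousOn p (Ici 0))
    (h : ∀ s > 0, HasDerivAt p (slopeField K (p s)) s) : ForwardSol K p := by
  intro s hs
  rcases (show 0 ≤ s from hs).lt_or_eq with hs | rfl
  · exact (h s hs).hasDerivWithinAt
  · refine hasDerivWithinAt_Ici_of_tendsto_deriv (s := Ioi 0)
      (fun s hs => (h s hs).differentiableAt.differentiableWithinAt)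
      ((hc 0 self_mem_Ici).mono Ioi_subset_Ici_self) self_mem_nhdsWithin ?_
    have h1 : Tendsto (fun s => slopeField K (p s)) (𝓝[>] 0) (𝓝 (slopeField K (p 0))) :=
      ((contDiff_slopeField K).continuous.tendsto _).comp
        ((hc 0 self_mem_Ici).mono Ioi_subset_Ici_self)
    refine h1.congr' ?_
    filter_upwards [self_mem_nhdsWithin] with s hs using (h s hs).deriv.symm

theorem ForwardSol.eq_of_eq {K : Fin 2 → ℝ} {p p' : ℝ → Fin 2 → ℝ} (h : ForwardSol K p)
    (h' : ForwardSol K p') (h0 : p 0 = p' 0) {T : ℝ} (hT : 0 ≤ T) : p T = p' T := by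
  have hs : Icc 0 T ⊆ Ici 0 := Icc_subset_Ici_self
  obtain ⟨r, hr⟩ := isCompact_Icc.exists_bound_of_continuousOn (h.continuousOn.mono hs)
  obtain ⟨r', hr'⟩ := isCompact_Icc.exists_bound_of_continuousOn (h'.continuousOn.mono hs)
  obtain ⟨κ, hκ⟩ := exists_lipschitzOnWith_slopeField K (max r r')
  exact ODE_solution_unique_of_mem_Icc_right (v := fun _ => slopeField K)
    (s := fun _ => Metric.closedBall 0 (max r r')) (fun _ _ => hκ)
    (h.continuousOn.mono hs) (fun t ht => (h t ht.1).mono (Ici_subset_Ici.2 ht.1))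
    (fun t ht => mem_closedBall_zero_iff.2 ((hr t (Ico_subset_Icc_self ht)).trans (le_max_left _ _)))
    (h'.continuousOn.mono hs) (fun t ht => (h' t ht.1).mono (Ici_subset_Ici.2 ht.1))
    (fun t ht => mem_closedBall_zero_iff.2
      ((hr' t (Ico_subset_Icc_self ht)).trans (le_max_right _ _))) h0 ⟨hT, le_rfl⟩

/-- Backward uniqueness against the rest point at the origin. It keeps Δ(p) positive along the whole
trajectory. -/
theorem ForwardSol.ne_zero {K : Fin 2 → ℝ} {p : ℝ → Fin 2 → ℝ} (h : ForwardSol K p)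
    (h0 : p 0 ≠ 0) {T : ℝ} (hT : 0 ≤ T) : p T ≠ 0 := by
  intro hz
  have hs : Icc 0 T ⊆ Ici 0 := Icc_subset_Ici_self
  obtain ⟨r, hr⟩ := isCompact_Icc.exists_bound_of_continuousOn (h.continuousOn.mono hs)
  obtain ⟨κ, hκ⟩ := exists_lipschitzOnWith_slopeField K (max r 0)
  refine h0 (ODE_solution_unique_of_mem_Icc_left (v := fun _ => slopeField K) (g := fun _ => 0)
    (s := fun _ => Metric.closedBall 0 (max r 0)) (fun _ _ => hκ)
    (h.continuousOn.mono hs) (fun t ht => (h.hasDerivAt ht.1).hasDerivWithinAt)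
    (fun t ht => mem_closedBall_zero_iff.2 ((hr t (Ioc_subset_Icc_self ht)).trans (le_max_left _ _)))
    continuousOn_const (fun t _ => ?_)
    (fun t _ => Metric.mem_closedBall_self (le_max_right _ _)) hz ⟨le_rfl, hT⟩)
  rw [slopeField_zero]
  exact hasDerivWithinAt_const _ _ _

theorem hasDerivAt_neg_comp_neg {E : Type*} [NormedAddCommGroup E] [NormedSpace ℝ E] {p : ℝ → E}
    {v : E} {s : ℝ} (h : HasDerivAt p v (-s)) : HasDerivAt (fun s => -p (-s)) v s := by
  exact (h.scomp s (hasDerivAt_neg s)).neg.congr_deriv (by simp)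

theorem IsTrajectory.forwardSol {K₀ K₁ : Fin 2 → ℝ} {p : ℝ → Fin 2 → ℝ}
    (h : IsTrajectory K₀ K₁ p) : ForwardSol K₁ p :=
  forwardSol_of_hasDerivAt h.1.continuousOn h.2.2

theorem IsTrajectory.forwardSol_neg {K₀ K₁ : Fin 2 → ℝ} {p : ℝ → Fin 2 → ℝ}
    (h : IsTrajectory K₀ K₁ p) : ForwardSol (-K₀) fun s => -p (-s) := by
  refine forwardSol_of_hasDerivAt (h.1.comp continuous_neg).neg.continuousOn fun s hs => ?_
  rw [slopeField_neg_neg]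
  exact hasDerivAt_neg_comp_neg (h.2.1 (-s) (by linarith))

theorem IsTrajectory.eq_of_eq {K₀ K₁ : Fin 2 → ℝ} {p p' : ℝ → Fin 2 → ℝ}
    (h : IsTrajectory K₀ K₁ p) (h' : IsTrajectory K₀ K₁ p') (h0 : p 0 = p' 0) : p = p' := by
  funext s
  rcases le_total 0 s with hs | hs
  · exact h.forwardSol.eq_of_eq h'.forwardSol h0 hs
  · simpa using h.forwardSol_neg.eq_of_eq h'.forwardSol_neg (by simpa using h0)
      (show 0 ≤ -s by linarith)

theorem mem_unstableSet_iff {K q : Fin 2 → ℝ} : q ∈ unstableSet K ↔ -q ∈ stableSet (-K) := by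
  have hmaps : MapsTo Neg.neg (Ici (0 : ℝ)) (Iic 0) := fun t ht => by
    simpa using ht
  have hmaps' : MapsTo Neg.neg (Iic (0 : ℝ)) (Ici 0) := fun t ht => by
    simpa using ht
  constructor
  · rintro ⟨p, hp0, hp, hlim⟩
    refine ⟨fun s => -p (-s), by simp [hp0], fun s hs => ?_, ?_⟩
    · rw [slopeField_neg_neg]
      exact ((hp (-s) (by simpa using hs)).scomp s
        (hasDerivAt_neg s).hasDerivWithinAt hmaps).neg.congr_deriv (by simp)
    · simpa using (hlim.comp tendsto_neg_atTop_atBot).neg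
  · rintro ⟨p, hp0, hp, hlim⟩
    refine ⟨fun s => -p (-s), by simp [hp0], fun s hs => ?_, ?_⟩
    · have h1 := hp (-s) (by simpa using hs)
      rw [← neg_neg (p (-s)), slopeField_neg_neg] at h1
      exact (h1.scomp s (hasDerivAt_neg s).hasDerivWithinAt hmaps').neg.congr_deriv (by simp)
    · simpa using (hlim.comp tendsto_neg_atBot_atTop).neg

/-- Two half-trajectories from the same point form a trajectory. -/
theorem exists_isTrajectory {K₀ K₁ q : Fin 2 → ℝ} {p₁ p₀ : ℝ → Fin 2 → ℝ} {R : ℝ}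
    (h₁ : ForwardSol K₁ p₁) (h₁q : p₁ 0 = q) (h₁K : Tendsto p₁ atTop (𝓝 K₁))
    (h₁R : ∀ s ≥ 0, ∀ i, |p₁ s i| ≤ R)
    (h₀ : ForwardSol (-K₀) p₀) (h₀q : p₀ 0 = -q) (h₀K : Tendsto p₀ atTop (𝓝 (-K₀)))
    (h₀R : ∀ s ≥ 0, ∀ i, |p₀ s i| ≤ R) :
    ∃ p, p 0 = q ∧ IsTrajectory K₀ K₁ p ∧ Tendsto p atBot (𝓝 K₀) ∧ Tendsto p atTop (𝓝 K₁) ∧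
      ∀ s i, |p s i| ≤ R := by
  -- On each half-line one of the two terms is frozen at its initial value and cancels against q;
  -- continuity is then immediate from the single formula.
  set p : ℝ → Fin 2 → ℝ := fun s => p₁ (max s 0) - p₀ (max (-s) 0) - q with hp
  have hpos : ∀ s ≥ 0, p s = p₁ s := fun s hs => by
    have hs : 0 ≤ s := hs
    simp [hp, hs, h₀q]
  have hneg : ∀ s ≤ 0, p s = -p₀ (-s) := fun s hs => by
    simp [hp, hs, h₁q]
  have hc : Continuous p := by
    have c1 : Continuous fun s : ℝ => p₁ (max s 0) :=
      h₁.continuousOn.comp_continuous (by fun_prop) fun s => mem_Ici.2 (le_max_right _ _)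
    have c0 : Continuous fun s : ℝ => p₀ (max (-s) 0) :=
      h₀.continuousOn.comp_continuous (by fun_prop) fun s => mem_Ici.2 (le_max_right _ _)
    exact (c1.sub c0).sub continuous_const
  refine ⟨p, by rw [hpos 0 le_rfl, h₁q], ⟨hc, fun s hs => ?_, fun s hs => ?_⟩, ?_, ?_, ?_⟩
  · have h1 := h₀.hasDerivAt (s := -s) (by linarith)
    rw [hneg s hs.le, ← slopeField_neg_neg, neg_neg]
    refine (hasDerivAt_neg_comp_neg h1).congr_of_eventuallyEq ?_
    filter_upwards [Iio_mem_nhds hs] with t ht using hneg t (le_of_lt ht)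
  · rw [hpos s hs.le]
    refine (h₁.hasDerivAt hs).congr_of_eventuallyEq ?_
    filter_upwards [Ioi_mem_nhds hs] with t ht using hpos t (le_of_lt ht)
  · have := (h₀K.comp tendsto_neg_atBot_atTop).neg
    rw [neg_neg] at this
    refine this.congr' ?_
    filter_upwards [eventually_le_atBot 0] with s hs using (hneg s hs).symm
  · refine h₁K.congr' ?_
    filter_upwards [eventually_ge_atTop 0] with s hs using (hpos s hs).symm
  · intro s i
    rcases le_total 0 s with hs | hs
    · rw [hpos s hs]; exact h₁R s hs i
    · rw [hneg s hs, Pi.neg_apply, abs_neg]; exact h₀R _ (by linarith) i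

/-! ### The change of variable -/

theorem Delta_eq (p : Fin 2 → ℝ) : Delta p = (p 0 + p 1) ^ 2 - p 0 * p 1 := by
  simp [Delta, Matrix.det_fin_two]
  ring

theorem Delta_pos {p : Fin 2 → ℝ} (hp : p ≠ 0) : 0 < Delta p := by
  rw [Delta_eq]
  by_contra! hle
  have h : p 0 ^ 2 = 0 ∧ p 1 ^ 2 = 0 := by
    constructor <;> nlinarith [sq_nonneg (p 0 + p 1), sq_nonneg (p 0), sq_nonneg (p 1)]
  exact hp (funext (Fin.forall_fin_two.2
    ⟨(pow_eq_zero_iff two_ne_zero).1 h.1, (pow_eq_zero_iff two_ne_zero).1 h.2⟩))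

theorem continuous_Delta : Continuous Delta := by
  have : Delta = fun p => (p 0 + p 1) ^ 2 - p 0 * p 1 := funext Delta_eq
  rw [this]
  fun_prop

theorem exists_pos_le_of_tendsto {f : ℝ → ℝ} {a b : ℝ} (hc : Continuous f) (hf : ∀ s, 0 < f s)
    (ha : 0 < a) (hb : 0 < b) (hta : Tendsto f atBot (𝓝 a)) (htb : Tendsto f atTop (𝓝 b)) :
    ∃ c > 0, ∀ s, c ≤ f s := by
  obtain ⟨A, hA⟩ := eventually_atBot.1 (hta.eventually (lt_mem_nhds (half_lt_self ha)))
  obtain ⟨B, hB⟩ := eventually_atTop.1 (htb.eventually (lt_mem_nhds (half_lt_self hb)))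
  obtain ⟨s₀, -, hs₀⟩ := (isCompact_uIcc (a := A) (b := B)).exists_isMinOn nonempty_uIcc
    hc.continuousOn
  refine ⟨min (f s₀) (min (a / 2) (b / 2)), lt_min (hf _) (lt_min (half_pos ha) (half_pos hb)),
    fun s => ?_⟩
  rcases le_total s A with h1 | h1
  · exact (min_le_right _ _).trans ((min_le_left _ _).trans (hA s h1).le)
  rcases le_total B s with h2 | h2
  · exact (min_le_right _ _).trans ((min_le_right _ _).trans (hB s h2).le)
  · exact (min_le_left _ _).trans (hs₀ (Icc_subset_uIcc ⟨h1, h2⟩))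

/-- A function with derivative bounded below by a positive constant has a Lipschitz inverse. -/
theorem exists_lipschitz_inverse {X D : ℝ → ℝ} {c : ℝ} (hc : 0 < c)
    (hX : ∀ s, HasDerivAt X (D s) s) (hD : ∀ s, c ≤ D s) :
    Function.Bijective X ∧ ∃ S : ℝ → ℝ, (∀ s, S (X s) = s) ∧ (∀ x, X (S x) = x) ∧ StrictMono S ∧
      LipschitzWith (c⁻¹).toNNReal S ∧ ∀ x, HasDerivAt S (D (S x))⁻¹ x := by
  have hexp : ∀ s t, s ≤ t → c * (t - s) ≤ X t - X s := fun s t hst =>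
    mul_sub_le_image_sub_of_le_deriv (fun s => (hX s).differentiableAt)
      (fun s => by rw [(hX s).deriv]; exact hD s) hst
  have hmono : StrictMono X := fun s t hst => by
    have := hexp s t hst.le
    nlinarith [mul_pos hc (sub_pos.2 hst)]
  have hcont : Continuous X := continuous_iff_continuousAt.2 fun s => (hX s).continuousAt
  have htop : Tendsto X atTop atTop := by
    refine tendsto_atTop_mono' _ ?_ (tendsto_atTop_add_const_right _ (X 0)
      (tendsto_id.const_mul_atTop hc))
    filter_upwards [eventually_ge_atTop 0] with s hs
    have := hexp 0 s hs
    simp only [id]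
    linarith
  have hbot : Tendsto X atBot atBot := by
    refine tendsto_atBot_mono' _ ?_ (tendsto_atBot_add_const_right _ (X 0)
      (tendsto_id.const_mul_atBot hc))
    filter_upwards [eventually_le_atBot 0] with s hs
    have := hexp s 0 hs
    simp only [id]
    linarith
  have hbij : Function.Bijective X := ⟨hmono.injective, hcont.surjective htop hbot⟩
  set e := Equiv.ofBijective X hbij with he
  have hl : ∀ s, e.symm (X s) = s := fun s => e.symm_apply_apply s
  have hr : ∀ x, X (e.symm x) = x := fun x => e.apply_symm_apply x
  have hSmono : StrictMono e.symm := fun x y hxy => by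
    rw [← hmono.lt_iff_lt, hr, hr]; exact hxy
  have hlip : LipschitzWith (c⁻¹).toNNReal e.symm := by
    refine LipschitzWith.of_dist_le_mul fun x y => ?_
    rw [Real.coe_toNNReal _ (inv_pos.2 hc).le, inv_mul_eq_div, le_div_iff₀ hc, mul_comm]
    rw [Real.dist_eq, Real.dist_eq]
    wlog hxy : y ≤ x generalizing x y
    · rw [abs_sub_comm, abs_sub_comm x]
      exact this y x (le_of_not_ge hxy)
    have h1 := hexp _ _ (hSmono.monotone hxy)
    rw [hr, hr] at h1
    rw [abs_of_nonneg (sub_nonneg.2 (hSmono.monotone hxy)), abs_of_nonneg (sub_nonneg.2 hxy)]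
    exact h1
  refine ⟨hbij, e.symm, hl, hr, hSmono, hlip, fun x => ?_⟩
  exact (hX _).of_local_left_inverse hlip.continuous.continuousAt
    (hc.trans_le (hD _)).ne' (Eventually.of_forall hr)

/-! ### Piecewise affine running costs -/

theorem eq_add_mul_of_hasDerivAt {f : ℝ → ℝ} {m : ℝ} (hc : Continuous f)
    (hf : ∀ x > 0, HasDerivAt f m x) {x : ℝ} (hx : 0 ≤ x) : f x = f 0 + m * x := by
  have hd : ∀ s > 0, HasDerivAt (fun x => f x - m * x) 0 s := fun s hs => by
    exact ((hf s hs).sub ((hasDerivAt_id s).const_mul m)).congr_deriv (by simp)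
  have hcont : ContinuousOn (fun x => f x - m * x) (Ici 0) := by fun_prop
  have h1 := mul_exp_le_of_mul_le_deriv (c := 0) hcont hd (by simp) x hx
  have h2 := mul_exp_le_of_mul_le_deriv (c := 0) hcont.neg (fun s hs => (hd s hs).neg)
    (by simp) x hx
  simp at h1 h2
  linarith

/-- A V-shaped piecewise affine function is bounded from below and grows at most linearly. -/
theorem bounds_of_hasDerivAt {f : ℝ → ℝ} {m₀ m₁ : ℝ} (hc : Continuous f) (h₀ : m₀ < 0)
    (h₁ : 0 < m₁) (hneg : ∀ x < 0, HasDerivAt f m₀ x) (hpos : ∀ x > 0, HasDerivAt f m₁ x)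
    {C : ℝ} (hC : |f 0| + |m₀| + |m₁| ≤ C) (x : ℝ) : -C ≤ f x ∧ |f x| ≤ C * (1 + |x|) := by
  have hm₀ := abs_nonneg m₀
  have hm₁ := abs_nonneg m₁
  have hf0 := abs_nonneg (f 0)
  have hf0' := neg_abs_le (f 0)
  have key : ∀ m y : ℝ, |m| ≤ |m₀| + |m₁| → f x = f 0 + m * y → |y| = |x| → 0 ≤ m * y →
      -C ≤ f x ∧ |f x| ≤ C * (1 + |x|) := by
    intro m y hm hfx hy hmy
    constructor
    · linarith
    · have h2 : |f x| ≤ |f 0| + |m| * |x| := by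
        rw [hfx, ← hy, ← abs_mul]
        exact abs_add_le _ _
      have h3 : |m| * |x| ≤ C * |x| := by
        gcongr
        linarith
      linarith
  rcases le_total 0 x with hx | hx
  · exact key m₁ x (by linarith) (eq_add_mul_of_hasDerivAt hc hpos hx) rfl (by positivity)
  · have h1 := eq_add_mul_of_hasDerivAt (f := fun x => f (-x)) (m := -m₀) (by fun_prop)
      (fun x hx => by
        exact ((hneg (-x) (by linarith)).scomp x (hasDerivAt_neg x)).congr_deriv (by simp)) (x := -x) (by linarith)
    simp only [neg_neg, neg_zero] at h1
    exact key (-m₀) (-x) (by rw [abs_neg]; linarith) h1 (abs_neg x)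
      (mul_nonneg (by linarith) (by linarith))

/-! ### Solutions of the game given by trajectories -/

/-- This is the differentiated Hamilton-Jacobi equation p_i = K_i - (p₁p₂)' - p_i p_i', multiplied
by Δ(p), with Δ(p)·dp/dx = dp/ds replaced by the field. -/
theorem Delta_mul_sub (K p : Fin 2 → ℝ) (i : Fin 2) :
    Delta p * (K i - p i) =
      slopeField K p 0 * p 1 + p 0 * slopeField K p 1 + p i * slopeField K p i := by
  rw [Delta_eq]
  fin_cases i <;> simp [slopeField] <;> ring

/-- Both fields are bounded on the ball that contains p. The switch at s = 0 may break
differentiability, so the mean value inequality is used with right derivatives. -/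
theorem lipschitzWith_of_isTrajectory {K₀ K₁ : Fin 2 → ℝ} {p : ℝ → Fin 2 → ℝ} {R : ℝ}
    (h : IsTrajectory K₀ K₁ p) (hR : ∀ s i, |p s i| ≤ R) : ∃ M, LipschitzWith M p := by
  have hR0 : 0 ≤ R := (abs_nonneg _).trans (hR 0 0)
  have hmem : ∀ s, p s ∈ Metric.closedBall (0 : Fin 2 → ℝ) R := fun s => by
    rw [mem_closedBall_zero_iff, pi_norm_le_iff_of_nonneg hR0]
    exact hR s
  obtain ⟨M₀, hM₀⟩ := exists_bound_slopeField K₀ R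
  obtain ⟨M₁, hM₁⟩ := exists_bound_slopeField K₁ R
  have hM : 0 ≤ max M₀ M₁ := (norm_nonneg _).trans ((hM₀ _ (hmem 0)).trans (le_max_left _ _))
  have hright : ∀ s, HasDerivWithinAt p (if s < 0 then slopeField K₀ (p s) else slopeField K₁ (p s))
      (Ici s) s := by
    intro s
    split_ifs with hs
    · exact (h.2.1 s hs).hasDerivWithinAt
    · exact (h.forwardSol s (not_lt.1 hs)).mono (Ici_subset_Ici.2 (not_lt.1 hs))
  refine ⟨(max M₀ M₁).toNNReal, LipschitzWith.of_dist_le_mul fun s t => ?_⟩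
  rw [Real.coe_toNNReal _ hM]
  wlog hst : t ≤ s generalizing s t
  · rw [dist_comm, dist_comm s]
    exact this t s (le_of_not_ge hst)
  rw [dist_eq_norm, Real.dist_eq, abs_of_nonneg (sub_nonneg.2 hst)]
  refine norm_image_sub_le_of_norm_deriv_right_le_segment h.1.continuousOn
    (fun x _ => hright x) (fun x _ => ?_) s ⟨hst, le_rfl⟩
  split_ifs
  · exact (hM₀ _ (hmem x)).trans (le_max_left _ _)
  · exact (hM₁ _ (hmem x)).trans (le_max_right _ _)

/-- The second conclusion retains the regular solution with the given bound R and its gradient q at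
x = 0; these supply distinct equilibria with a common control set. -/
theorem givesSolution_of_isTrajectory {K₀ K₁ q : Fin 2 → ℝ} {h : Fin 2 → ℝ → ℝ}
    (hK₀ : ∀ i, K₀ i < 0) (hK₁ : ∀ i, 0 < K₁ i) (hcont : ∀ i, Continuous (h i))
    (hneg : ∀ i, ∀ x < 0, HasDerivAt (h i) (K₀ i) x)
    (hpos : ∀ i, ∀ x > 0, HasDerivAt (h i) (K₁ i) x)
    {p : ℝ → Fin 2 → ℝ} {R : ℝ} (hp : IsTrajectory K₀ K₁ p) (hpq : p 0 = q) (hq : q ≠ 0)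
    (hbot : Tendsto p atBot (𝓝 K₀)) (htop : Tendsto p atTop (𝓝 K₁))
    (hR : ∀ s i, |p s i| ≤ R) :
    GivesSolution h K₀ K₁ q ∧ ∃ (P u : Fin 2 → ℝ → ℝ) (C : ℝ),
      RegularSolution h P u R C ∧ ∀ i, P i 0 = q i := by
  have hne : ∀ s, p s ≠ 0 := by
    intro s
    rcases le_total 0 s with hs | hs
    · exact hp.forwardSol.ne_zero (by rwa [hpq]) hs
    · have := hp.forwardSol_neg.ne_zero (by simpa [hpq] using hq) (show 0 ≤ -s by linarith)
      simpa using this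
  have hDc : Continuous fun s => Delta (p s) := continuous_Delta.comp hp.1
  obtain ⟨c, hc, hcD⟩ := exists_pos_le_of_tendsto hDc (fun s => Delta_pos (hne s))
    (Delta_pos (p := K₀) fun hz => (hK₀ 0).ne (by rw [hz]; rfl))
    (Delta_pos (p := K₁) fun hz => (hK₁ 0).ne' (by rw [hz]; rfl))
    ((continuous_Delta.tendsto K₀).comp hbot) ((continuous_Delta.tendsto K₁).comp htop)
  set X : ℝ → ℝ := fun s => ∫ t in (0 : ℝ)..s, Delta (p t) with hXdef
  have hX : ∀ s, HasDerivAt X (Delta (p s)) s := fun s =>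
    intervalIntegral.integral_hasDerivAt_right (hDc.intervalIntegrable _ _)
      (hDc.stronglyMeasurableAtFilter _ _) hDc.continuousAt
  have hX0 : X 0 = 0 := by simp [hXdef]
  obtain ⟨hbij, S, hSX, hXS, hSmono, hSlip, hSd⟩ := exists_lipschitz_inverse hc hX hcD
  have hS0 : S 0 = 0 := by rw [← hX0, hSX]; exact hX0.symm
  obtain ⟨M, hM⟩ := lipschitzWith_of_isTrajectory hp hR
  set P : Fin 2 → ℝ → ℝ := fun i x => p (S x) i with hP
  have hPc : ∀ i, Continuous (P i) := fun i =>
    (continuous_apply i).comp (hp.1.comp hSlip.continuous)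
  -- u is defined by the equation it has to satisfy; what needs proof is that its derivative is P.
  set u : Fin 2 → ℝ → ℝ := fun i x => h i x - P 0 x * P 1 x - P i x ^ 2 / 2 with hu
  have hPd : ∀ (K : Fin 2 → ℝ) (x : ℝ), HasDerivAt p (slopeField K (p (S x))) (S x) → ∀ i,
      HasDerivAt (P i) (slopeField K (p (S x)) i * (Delta (p (S x)))⁻¹) x := by
    intro K x hd i
    exact (hasDerivAt_pi.1 hd i).comp x (hSd x)
  have hud : ∀ (K : Fin 2 → ℝ) (x : ℝ), HasDerivAt p (slopeField K (p (S x))) (S x) → ∀ i,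
      HasDerivAt (h i) (K i) x → HasDerivAt (u i) (P i x) x := by
    intro K x hd i hh
    have h1 := ((hh.sub ((hPd K x hd 0).mul (hPd K x hd 1))).sub
      (((hPd K x hd i).pow 2).div_const 2))
    refine h1.congr_deriv ?_
    have hΔ := (Delta_pos (hne (S x))).ne'
    have h2 := Delta_mul_sub K (p (S x)) i
    simp only [hP]
    field_simp
    push_cast
    linear_combination 2 * h2
  have hderiv : ∀ i x, HasDerivAt (u i) (P i x) x := by
    intro i
    have hoff : ∀ x ≠ 0, HasDerivAt (u i) (P i x) x := by
      intro x hx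
      rcases hx.lt_or_gt with hx | hx
      · exact hud K₀ x (hp.2.1 _ (by rw [← hS0]; exact hSmono hx)) i (hneg i x hx)
      · exact hud K₁ x (hp.2.2 _ (by rw [← hS0]; exact hSmono hx)) i (hpos i x hx)
    intro x
    rcases eq_or_ne x 0 with rfl | hx
    -- h and P may have a corner at 0, but u' = P off 0 and P is continuous, so the corners cancel
    -- in u.
    · refine hasDerivAt_of_hasDerivAt_of_ne hoff ?_ (hPc i).continuousAt
      exact (((hcont i).sub ((hPc 0).mul (hPc 1))).sub
        (((hPc i).pow 2).div_const 2)).continuousAt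
    · exact hoff x hx
  set C := ∑ i, (|h i 0| + |K₀ i| + |K₁ i|) with hC
  have hCi : ∀ i, |h i 0| + |K₀ i| + |K₁ i| ≤ C := fun i =>
    Finset.single_le_sum (f := fun i => |h i 0| + |K₀ i| + |K₁ i|) (fun _ _ => by positivity)
      (Finset.mem_univ i)
  have hreg : RegularSolution h P u R C :=
    { cont := hcont
      lower := fun i x =>
        (bounds_of_hasDerivAt (hcont i) (hK₀ i) (hK₁ i) (hneg i) (hpos i) (hCi i) x).1
      growth := fun i x =>
        (bounds_of_hasDerivAt (hcont i) (hK₀ i) (hK₁ i) (hneg i) (hpos i) (hCi i) x).2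
      lipschitz := fun i => ⟨_, ((LipschitzWith.eval i).comp (hM.comp hSlip))⟩
      bound := fun i x => hR _ i
      deriv := hderiv
      eqn := fun _ _ => rfl }
  refine ⟨⟨p, hpq, hp, fun p' hp' hq' => hp'.eq_of_eq hp (hq'.trans hpq.symm), hbot, htop, X, u,
    hX0, hX, hbij, fun i s => ?_, hreg.isAdmissible, fun A hA => hreg.isNash hA⟩,
    P, u, C, hreg, fun i => by simp only [hP, hS0, hpq]⟩
  have := hderiv i (X s)
  simp only [hP, hSX] at this
  exact this

/-! ### The cone -/

theorem neg_of_mem_sector {K : Fin 2 → ℝ} (hK : K ∈ sector 5 ∪ sector 6) (i : Fin 2) :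
    K i < 0 := by
  have key : ∃ ρ θ : ℝ, 0 < ρ ∧ Real.pi < θ ∧ θ < 3 * Real.pi / 2 ∧
      K = ![ρ * Real.cos θ, ρ * Real.sin θ] := by
    have := Real.pi_pos
    rcases hK with ⟨ρ, θ, hρ, hθ, h⟩ | ⟨ρ, θ, hρ, hθ, h⟩ <;>
    · have h1 := hθ.1
      have h2 := hθ.2
      push_cast at h1 h2
      exact ⟨ρ, θ, hρ, by linarith, by linarith, h⟩
  obtain ⟨ρ, θ, hρ, h1, h2, rfl⟩ := key
  fin_cases i
  · exact mul_neg_of_pos_of_neg hρ (Real.cos_neg_of_pi_div_two_lt_of_lt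
      (by linarith [Real.pi_pos]) (by linarith))
  · refine mul_neg_of_pos_of_neg hρ ?_
    have := Real.sin_pos_of_pos_of_lt_pi (x := θ - Real.pi) (by linarith)
      (by linarith [Real.pi_pos])
    rw [Real.sin_sub_pi] at this
    linarith

theorem pos_of_mem_sector {K : Fin 2 → ℝ} (hK : K ∈ sector 1 ∪ sector 2) (i : Fin 2) :
    0 < K i := by
  have key : ∃ ρ θ : ℝ, 0 < ρ ∧ 0 < θ ∧ θ < Real.pi / 2 ∧
      K = ![ρ * Real.cos θ, ρ * Real.sin θ] := by
    have := Real.pi_pos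
    rcases hK with ⟨ρ, θ, hρ, hθ, h⟩ | ⟨ρ, θ, hρ, hθ, h⟩ <;>
    · have h1 := hθ.1
      have h2 := hθ.2
      push_cast at h1 h2
      exact ⟨ρ, θ, hρ, by linarith, by linarith, h⟩
  obtain ⟨ρ, θ, hρ, h1, h2, rfl⟩ := key
  fin_cases i
  · exact mul_pos hρ (Real.cos_pos_of_mem_Ioo ⟨by linarith [Real.pi_pos], h2⟩)
  · exact mul_pos hρ (Real.sin_pos_of_pos_of_lt_pi h1 (by linarith [Real.pi_pos]))

/-- The root √(a² - a + 1) exceeds a - 1/2, so it increases more slowly than a. Monotonicity fixes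
which edge of the cone belongs to which curve. -/
theorem Gminus_strictMono : StrictMono Gminus := by
  intro a b hab
  set s := Real.sqrt (a ^ 2 - a + 1) with hs
  have hrad : 0 < a ^ 2 - a + 1 := by nlinarith [sq_nonneg (a - 1 / 2)]
  have hs0 : 0 < s := Real.sqrt_pos.2 hrad
  have hs2 : s ^ 2 = a ^ 2 - a + 1 := Real.sq_sqrt hrad.le
  have hsa : a - 1 / 2 < s := by
    by_contra! hle
    nlinarith
  have : Real.sqrt (b ^ 2 - b + 1) < b - a + s := by
    rw [Real.sqrt_lt' (by linarith)]
    nlinarith [mul_pos (sub_pos.2 hab) (sub_pos.2 hsa)]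
  simp only [Gminus]
  linarith

theorem Gminus_neg {a : ℝ} (ha : 0 < a) : Gminus a < 0 := by
  have : a - 1 < Real.sqrt (a ^ 2 - a + 1) := by
    refine Real.lt_sqrt_of_sq_lt ?_
    nlinarith
  simp only [Gminus]
  linarith

theorem mem_coneOmega_of_lt {α₀ α₁ t r : ℝ} (h : α₀ < α₁) (hr : 0 < r) (ht : t < 0)
    (h0 : Gminus α₀ < t) (h1 : t < Gminus α₁) : ![-r, -r * t] ∈ coneOmega α₀ α₁ := by
  refine Or.inl ⟨h, by simpa using hr, ?_, ?_⟩
  · simpa using mul_neg_of_pos_of_neg hr ht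
  · simpa [hr.ne'] using ⟨h0, h1⟩

theorem mem_coneOmega_of_gt {α₀ α₁ t r : ℝ} (h : α₁ < α₀) (hr : 0 < r) (ht : t < 0)
    (h1 : Gminus α₁ < t) (h0 : t < Gminus α₀) : ![r, r * t] ∈ coneOmega α₀ α₁ := by
  refine Or.inr ⟨h, ?_, by simpa using hr, ?_⟩
  · simpa using mul_neg_of_pos_of_neg hr ht
  · simpa [hr.ne'] using ⟨h1, h0⟩

/-- A ray inside the cone. -/
theorem exists_ray_coneOmega {α₀ α₁ : ℝ} (h₀ : 0 < α₀) (h₁ : 0 < α₁) (hne : α₁ ≠ α₀) :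
    ∃ t v : ℝ, v ≠ 0 ∧
      t ∈ Ioo (min (Gminus α₀) (Gminus α₁)) (max (Gminus α₀) (Gminus α₁)) ∧
      ∀ r > 0, ![r * v, r * v * t] ∈ coneOmega α₀ α₁ := by
  rcases hne.lt_or_gt with h | h
  · have hG := Gminus_strictMono h
    obtain ⟨t, ht1, ht2⟩ := exists_between hG
    refine ⟨t, 1, one_ne_zero, ?_, fun r hr => ?_⟩
    · rw [min_eq_right hG.le, max_eq_left hG.le]; exact ⟨ht1, ht2⟩
    · simpa using mem_coneOmega_of_gt h hr (ht2.trans (Gminus_neg h₀)) ht1 ht2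
  · have hG := Gminus_strictMono h
    obtain ⟨t, ht1, ht2⟩ := exists_between hG
    refine ⟨t, -1, by norm_num, ?_, fun r hr => ?_⟩
    · rw [min_eq_left hG.le, max_eq_right hG.le]; exact ⟨ht1, ht2⟩
    · simpa using mem_coneOmega_of_lt h hr (ht2.trans (Gminus_neg h₁)) ht1 ht2

theorem exists_abs_sub_le_of_hasDerivAt_zero {φ : ℝ → ℝ} {G δ : ℝ} (h : HasDerivAt φ G 0)
    (h0 : φ 0 = 0) (hδ : 0 < δ) : ∃ ε > 0, ∀ x, |x| < ε → |φ x - G * x| ≤ δ * |x| := by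
  rw [hasDerivAt_iff_isLittleO, Asymptotics.isLittleO_iff] at h
  obtain ⟨ε, hε, hball⟩ := Metric.eventually_nhds_iff.1 (h hδ)
  refine ⟨ε, hε, fun x hx => ?_⟩
  have := hball (show dist x 0 < ε by simpa using hx)
  simpa [h0, mul_comm] using this

/-- Near the origin, a closed subcone lies strictly between two curves that are tangent to the
edges of the cone. -/
theorem exists_between_of_mem_coneOmega {α₀ α₁ a b : ℝ} {φ₀ φ₁ : ℝ → ℝ}
    (h₀ : HasDerivAt φ₀ (Gminus α₀) 0) (h₀z : φ₀ 0 = 0)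
    (h₁ : HasDerivAt φ₁ (Gminus α₁) 0) (h₁z : φ₁ 0 = 0)
    (hab : Icc a b ⊆ Ioo (min (Gminus α₀) (Gminus α₁)) (max (Gminus α₀) (Gminus α₁))) :
    ∃ ε > 0, ∀ q ∈ coneOmega α₀ α₁, q 1 / q 0 ∈ Icc a b → ‖q‖ < ε →
      φ₁ (q 0) < q 1 ∧ q 1 < φ₀ (q 0) := by
  rcases lt_or_ge b a with hba | hle
  · exact ⟨1, one_pos, fun q _ hq => absurd (hq.1.trans hq.2) (not_le.2 hba)⟩
  have ha := (hab ⟨le_rfl, hle⟩).1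
  have hb := (hab ⟨hle, le_rfl⟩).2
  set m := min (Gminus α₀) (Gminus α₁) with hm
  set M := max (Gminus α₀) (Gminus α₁) with hM
  -- Less than the gap between [a, b] and the edge slopes, so tangency up to δ|q₁| separates the
  -- subcone from both curves. In the second quadrant the negative first coordinate reverses the
  -- order of slopes, so both forms of the cone give the same inequalities.
  set δ := min (a - m) (M - b) / 2 with hδ
  have hmin : 0 < min (a - m) (M - b) := lt_min (by linarith) (by linarith)
  have hδ0 : 0 < δ := half_pos hmin
  have hδa : δ < a - m := (half_lt_self hmin).trans_le (min_le_left _ _)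
  have hδb : δ < M - b := (half_lt_self hmin).trans_le (min_le_right _ _)
  obtain ⟨ε₀, hε₀, hφ₀⟩ := exists_abs_sub_le_of_hasDerivAt_zero h₀ h₀z hδ0
  obtain ⟨ε₁, hε₁, hφ₁⟩ := exists_abs_sub_le_of_hasDerivAt_zero h₁ h₁z hδ0
  refine ⟨min ε₀ ε₁, lt_min hε₀ hε₁, fun q hq hr hqε => ?_⟩
  have hq0 : |q 0| ≤ ‖q‖ := norm_le_pi_norm q 0
  have e0 := abs_le.1 (hφ₀ (q 0) (hq0.trans_lt (hqε.trans_le (min_le_left _ _))))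
  have e1 := abs_le.1 (hφ₁ (q 0) (hq0.trans_lt (hqε.trans_le (min_le_right _ _))))
  rcases hq with ⟨hα, hneg, -, -, -⟩ | ⟨hα, -, hpos, -, -⟩
  · have hG := Gminus_strictMono hα
    rw [hm, min_eq_left hG.le] at hδa
    rw [hM, max_eq_right hG.le] at hδb
    set t := q 1 / q 0 with ht
    have hq1 : q 1 = t * q 0 := by rw [ht, div_mul_cancel₀ _ hneg.ne]
    rw [abs_of_neg hneg] at e0 e1
    have p0 : 0 < (t - Gminus α₀ - δ) * -q 0 := mul_pos (by linarith [hr.1]) (by linarith)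
    have p1 : 0 < (Gminus α₁ - t - δ) * -q 0 := mul_pos (by linarith [hr.2]) (by linarith)
    constructor <;> nlinarith
  · have hG := Gminus_strictMono hα
    rw [hm, min_eq_right hG.le] at hδa
    rw [hM, max_eq_left hG.le] at hδb
    set t := q 1 / q 0 with ht
    have hq1 : q 1 = t * q 0 := by rw [ht, div_mul_cancel₀ _ hpos.ne']
    rw [abs_of_pos hpos] at e0 e1
    have p0 : 0 < (Gminus α₀ - t - δ) * q 0 := mul_pos (by linarith [hr.2]) (by linarith)
    have p1 : 0 < (t - Gminus α₁ - δ) * q 0 := mul_pos (by linarith [hr.1]) (by linarith)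
    constructor <;> nlinarith

theorem slopeRatio_neg (K : Fin 2 → ℝ) : slopeRatio (-K) = slopeRatio K := by
  simp [slopeRatio, neg_div_neg_eq]

theorem mainTheorem5 (K₀ K₁ : Fin 2 → ℝ)
    (hK₀ : K₀ ∈ sector 5 ∪ sector 6) (hK₁ : K₁ ∈ sector 1 ∪ sector 2)
    (hα : slopeRatio K₁ ≠ slopeRatio K₀)
    (h : Fin 2 → ℝ → ℝ) (hcont : ∀ i, Continuous (h i))
    (hneg : ∀ i, ∀ x < 0, HasDerivAt (h i) (K₀ i) x)
    (hpos : ∀ i, ∀ x > 0, HasDerivAt (h i) (K₁ i) x) :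
    -- the cone is not empty
    (coneOmega (slopeRatio K₀) (slopeRatio K₁)).Nonempty ∧
    -- every point of a closed subcone that is near enough to the origin gives a solution
    (∀ a b : ℝ,
      Set.Icc a b ⊆ Set.Ioo (min (Gminus (slopeRatio K₀)) (Gminus (slopeRatio K₁)))
        (max (Gminus (slopeRatio K₀)) (Gminus (slopeRatio K₁))) →
      ∃ ε > 0, ∀ q ∈ coneOmega (slopeRatio K₀) (slopeRatio K₁),
        q 1 / q 0 ∈ Set.Icc a b → ‖q‖ < ε → GivesSolution h K₀ K₁ q) ∧
    -- near the origin, the stable orbit of the positive system and the unstable orbit of the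
    -- negative system are curves tangent to the edges of the cone, and every point
    -- between them gives a solution
    (∃ ε > 0, ∃ φ₀ φ₁ : ℝ → ℝ,
      ContinuousOn φ₀ (Set.Ioo (-ε) ε) ∧ ContinuousOn φ₁ (Set.Ioo (-ε) ε) ∧
      φ₀ 0 = 0 ∧ HasDerivAt φ₀ (Gminus (slopeRatio K₀)) 0 ∧
      φ₁ 0 = 0 ∧ HasDerivAt φ₁ (Gminus (slopeRatio K₁)) 0 ∧
      (∀ q : Fin 2 → ℝ, ‖q‖ < ε → (q ∈ unstableSet K₀ ↔ q 1 = φ₀ (q 0))) ∧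
      (∀ q : Fin 2 → ℝ, ‖q‖ < ε → (q ∈ stableSet K₁ ↔ q 1 = φ₁ (q 0))) ∧
      (∀ q : Fin 2 → ℝ, ‖q‖ < ε → φ₁ (q 0) < q 1 → q 1 < φ₀ (q 0) →
        GivesSolution h K₀ K₁ q)) ∧
    -- there are infinitely many admissible solutions
    {u : Fin 2 → ℝ → ℝ | IsAdmissible h u}.Infinite ∧
    -- they yield infinitely many Nash equilibria, for all large enough control sets
    (∃ R : ℝ, ∀ A : Fin 2 → Set ℝ, (∀ i, Set.Icc (-R) R ⊆ A i) →
      {α : Fin 2 → ℝ → ℝ |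
        ∃ u, IsAdmissible h u ∧ α = feedback u ∧ IsNash A h α}.Infinite) := by
  have hn := neg_of_mem_sector hK₀
  have hp := pos_of_mem_sector hK₁
  have hα₀ : 0 < slopeRatio K₀ := div_pos_of_neg_of_neg (hn 1) (hn 0)
  have hα₁ : 0 < slopeRatio K₁ := div_pos (hp 1) (hp 0)
  obtain ⟨ε₁, hε₁, φ₁, R₁, hφ₁c, hφ₁z, hφ₁d, hφ₁s, hφ₁b⟩ := exists_stableCurve (hp 0) (hp 1)
  obtain ⟨ε₀, hε₀, ψ, R₀, hψc, hψz, hψd, hψs, hψb⟩ := exists_stableCurve (K := -K₀)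
    (by simpa using hn 0) (by simpa using hn 1)
  rw [slopeRatio_neg] at hψd
  -- The stable curve for -K₀, reflected through the origin: the slope at 0 is unchanged, and lying
  -- below φ₀ means that -q lies above ψ.
  set φ₀ : ℝ → ℝ := fun x => -ψ (-x) with hφ₀
  have hφ₀z : φ₀ 0 = 0 := by simp [hφ₀, hψz]
  have hφ₀d : HasDerivAt φ₀ (Gminus (slopeRatio K₀)) 0 :=
    hasDerivAt_neg_comp_neg (by simpa using hψd)
  set ε := min ε₀ ε₁ with hε
  set R := max R₀ R₁ with hR
  have hbetween : ∀ q : Fin 2 → ℝ, ‖q‖ < ε → φ₁ (q 0) < q 1 → q 1 < φ₀ (q 0) →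
      GivesSolution h K₀ K₁ q ∧ ∃ (P u : Fin 2 → ℝ → ℝ) (C : ℝ),
        RegularSolution h P u R C ∧ ∀ i, P i 0 = q i := by
    intro q hq h1 h0
    obtain ⟨p₁, hp₁q, hp₁, hp₁K, hp₁R⟩ := hφ₁b q (hq.trans_le (min_le_right _ _)) h1
    obtain ⟨p₀, hp₀q, hp₀, hp₀K, hp₀R⟩ := hψb (-q)
      (by rw [norm_neg]; exact hq.trans_le (min_le_left _ _))
      (by simp only [hφ₀] at h0; simp only [Pi.neg_apply]; linarith)
    have hq0 : q ≠ 0 := by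
      rintro rfl
      simp only [Pi.zero_apply, hφ₁z, lt_irrefl] at h1
    obtain ⟨p, hpq, hpt, hbot, htop, hpR⟩ := exists_isTrajectory hp₁ hp₁q hp₁K
      (fun s hs i => (hp₁R s hs i).trans (le_max_right R₀ R₁)) hp₀ hp₀q hp₀K
      (fun s hs i => (hp₀R s hs i).trans (le_max_left R₀ R₁))
    exact givesSolution_of_isTrajectory hn hp hcont hneg hpos hpt hpq hq0 hbot htop hpR
  have hcone : ∀ a b : ℝ,
      Icc a b ⊆ Ioo (min (Gminus (slopeRatio K₀)) (Gminus (slopeRatio K₁)))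
        (max (Gminus (slopeRatio K₀)) (Gminus (slopeRatio K₁))) →
      ∃ ε > 0, ∀ q ∈ coneOmega (slopeRatio K₀) (slopeRatio K₁),
        q 1 / q 0 ∈ Icc a b → ‖q‖ < ε → GivesSolution h K₀ K₁ q ∧
          ∃ (P u : Fin 2 → ℝ → ℝ) (C : ℝ), RegularSolution h P u R C ∧ ∀ i, P i 0 = q i := by
    intro a b hab
    obtain ⟨η, hη, hq⟩ := exists_between_of_mem_coneOmega hφ₀d hφ₀z hφ₁d hφ₁z hab
    refine ⟨min η ε, lt_min hη (lt_min hε₀ hε₁), fun q hqm hr hqn => ?_⟩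
    have := hq q hqm hr (hqn.trans_le (min_le_left _ _))
    exact hbetween q (hqn.trans_le (min_le_right _ _)) this.1 this.2
  obtain ⟨t, v, hv, ht, hray⟩ := exists_ray_coneOmega hα₀ hα₁ hα
  -- a sequence of solutions with distinct gradients at the origin
  have hseq : ∃ P u : ℕ → Fin 2 → ℝ → ℝ, (∀ n, ∃ C, RegularSolution h (P n) (u n) R C) ∧
      Function.Injective fun n => P n 0 0 := by
    -- The degenerate interval a = b = t suffices: points of a single ray that shrink to the origin
    -- give gradients at 0 with distinct first components.
    obtain ⟨η, hη, hsol⟩ := hcone t t (by simpa using ht)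
    set N := ‖(![v, v * t] : Fin 2 → ℝ)‖ with hN
    have hN0 : 0 ≤ N := norm_nonneg _
    set r : ℕ → ℝ := fun n => η / (N + 1) / (n + 1) with hr
    have hr0 : ∀ n, 0 < r n := fun n => by positivity
    have hqn : ∀ n, ![r n * v, r n * v * t] = r n • (![v, v * t] : Fin 2 → ℝ) := fun n => by
      ext i
      fin_cases i <;> simp [mul_assoc]
    have hsm : ∀ n, ‖(![r n * v, r n * v * t] : Fin 2 → ℝ)‖ < η := fun n => by
      rw [hqn, norm_smul, Real.norm_of_nonneg (hr0 n).le]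
      have h1 : r n ≤ η / (N + 1) :=
        div_le_self (by positivity) (by linarith [n.cast_nonneg (α := ℝ)])
      calc r n * N ≤ η / (N + 1) * N := by gcongr
        _ < η := by
          rw [div_mul_eq_mul_div, div_lt_iff₀ (by positivity)]
          linarith
    choose P u C hreg hP using fun n => (hsol _ (hray (r n) (hr0 n))
      (by simp [mul_div_cancel_left₀ t (mul_ne_zero (hr0 n).ne' hv)]) (hsm n)).2
    refine ⟨P, u, fun n => ⟨C n, hreg n⟩, fun m n hmn => ?_⟩
    simp only [hP] at hmn
    have h1 : r m = r n := mul_right_cancel₀ hv (by simpa using hmn)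
    simp only [hr] at h1
    have h2 : η / (N + 1) ≠ 0 := by positivity
    have h3 : ((m : ℝ) + 1) = n + 1 := by
      field_simp at h1
      linarith
    exact_mod_cast add_right_cancel h3
  obtain ⟨P, u, hreg, hinj⟩ := hseq
  refine ⟨⟨_, hray 1 one_pos⟩, fun a b hab => ?_, ⟨ε, lt_min hε₀ hε₁, φ₀, φ₁, ?_, ?_, hφ₀z, hφ₀d,
    hφ₁z, hφ₁d, fun q hq => ?_, fun q hq => hφ₁s q (hq.trans_le (min_le_right _ _)),
    fun q hq h1 h0 => (hbetween q hq h1 h0).1⟩, ?_, R, fun A hA => ?_⟩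
  · obtain ⟨η, hη, hq⟩ := hcone a b hab
    exact ⟨η, hη, fun q hqm hr hqn => (hq q hqm hr hqn).1⟩
  · refine (hψc.comp continuous_neg.continuousOn fun x hx => ?_).neg
    have := min_le_left ε₀ ε₁
    exact ⟨by linarith [hx.2], by linarith [hx.1]⟩
  · exact hφ₁c.mono (Ioo_subset_Ioo (neg_le_neg (min_le_right _ _)) (min_le_right _ _))
  · rw [mem_unstableSet_iff, hψs (-q) (by rw [norm_neg]; exact hq.trans_le (min_le_left _ _))]
    simp only [hφ₀, Pi.neg_apply, neg_eq_iff_eq_neg]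
  -- The functions u are told apart by their gradients at x = 0, as are the feedbacks below.
  · refine infinite_of_injective_forall_mem (f := u) (fun m n hmn => hinj ?_) fun n => ?_
    · obtain ⟨_, hm⟩ := hreg m
      obtain ⟨_, hn⟩ := hreg n
      simp only [← hm.deriv_eq, ← hn.deriv_eq, hmn]
    · exact (hreg n).choose_spec.isAdmissible
  · refine infinite_of_injective_forall_mem (f := fun n => feedback (u n))
      (fun m n hmn => hinj ?_) fun n => ?_
    · obtain ⟨_, hm⟩ := hreg m
      obtain ⟨_, hn⟩ := hreg n
      have := congrFun (congrFun hmn 0) 0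
      simpa [hm.feedback_apply, hn.feedback_apply] using this
    · obtain ⟨_, hn⟩ := hreg n
      refine ⟨u n, hn.isAdmissible, rfl, hn.isNash fun i x => hA i ?_⟩
      rw [hn.feedback_apply]
      exact abs_le.1 (by rw [abs_neg]; exact hn.bound i x)
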